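/- Let $f,g:\mathbb R^d\to\mathbb R^d$ be $C^\infty$ and consider the Stratonovich SDE $dy=f(y)\,dt+g(y)\circ dW(t)$, $y(0)=y_0$, where $W$ is a one-dimensional standard Brownian motion, $y_0$ is independent of $W$ with $E\|y_0\|^2<\infty$, and the Itô drift $\underline f=f+\frac12\frac{\partial g}{\partial y}g$ and $g$ satisfy, for all $x,y$, $\|\underline f(y)-\underline f(x)\|+\|g(y)-g(x)\|\le L_1\|y-x\|$ and $\|\underline f(y)\|^2+\|g(y)\|^2\le L_2(1+\|y\|^2)$. Suppose that $I(y)=y^TCy$, with $C$ symmetric, is an invariant of the SDE, i.e. $\nabla I^Tf=\nabla I^Tg=0$. Consider an $s$-stage stochastic Runge–Kutta (SRK) method with real coefficients $A=(a_{ij})$, $B=(b_{ij})$, $\alpha$, $\beta$: $$Y_i=y_n+h\sum_{j=1}^s a_{ij}f(Y_j)+\Delta W_n\sum_{j=1}^s b_{ij}g(Y_j),\quad i=1,\dots,s,$$ $$y_{n+1}=y_n+h\sum_{i=1}^s\alpha_if(Y_i)+\Delta W_n\sum_{i=1}^s\beta_ig(Y_i),\qquad \Delta W_n=W((n+1)h)-W(nh).$$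 The method is called explicit if $A$ and $B$ are strictly lower triangular. Put $$M^0=\mathrm{diag}(\alpha)A+A^T\mathrm{diag}(\alpha)-\alpha\alpha^T,\quad M^1=\mathrm{diag}(\beta)B+B^T\mathrm{diag}(\beta)-\beta\beta^T,\quad M^*=\mathrm{diag}(\alpha)B+A^T\mathrm{diag}(\beta)-\alpha\beta^T.$$ Let $\Gamma_0$ (resp. $\Gamma_1$) be the set of non-empty rooted trees with nodes coloured by $\{0,1\}$ whose root has colour $0$ (resp. $1$). Write $\iota=[\iota_1,\dots,\iota_\ell]_k$ for the tree with root of colour $k$ and subtrees $\iota_1,\dots,\iota_\ell$, $\ell\ge0$. If $\iota$ has $n_0$ nodes of colour $0$ and $n_1$ nodes of colour $1$, put $\mathrm{ord}(\iota)=n_0+\frac12n_1$. Define $\Phi(\iota)\in\mathbb R^s$ recursively: $\Phi([\iota_1,\dots,\iota_\ell]_k)$ is the componentwise product of the vectors $Z_j\Phi(\iota_j)$, $j=1,\dots,\ell$, where $Z_j=A$ if $\iota_j\in\Gamma_0$ and $Z_j=B$ if $\iota_j\in\Gamma_1$; for $\ell=0$ it is $(1,\dots,1)^T$. Let $\gamma\in\{0,\frac12,1,\frac32,\dots\}$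 and suppose that - $\Phi(\iota)^TM^0\Phi(\iota')=0$ for all $\iota,\iota'\in\Gamma_0$, - $\Phi(\iota)^TM^*\Phi(\iota')=0$ for all $\iota\in\Gamma_0$, $\iota'\in\Gamma_1$, - $\Phi(\iota)^TM^1\Phi(\iota')=0$ for all $\iota,\iota'\in\Gamma_1$, in each case whenever $\mathrm{ord}(\iota)+\mathrm{ord}(\iota')\le\gamma+\frac12$. Then for every $\varepsilon>0$ there are a finite non-negative random variable $C(\varepsilon)$ and a random variable $\rho$ with values in $(0,1]$, where $\rho\equiv1$ if the method is explicit, such that almost surely, for all $h\in(0,\rho]$ and all integers $N_T\ge0$ with $N_Th\le1$, every numerical solution $y_0,y_1,\dots,y_{N_T}$ of the method with step size $h$ satisfies $$|I(y_{N_T})-I(y_0)|\le C(\varepsilon)\,h^{\gamma-\varepsilon}.$$ In particular, for an explicit method one random variable $C(\varepsilon)$ serves all step sizes $h\in(0,1]$ and all $N_T$ with $N_Th\le1$: the explicit SRK method preserves the quadratic invariant to order $\gamma-\varepsilon$. -/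

import Mathlib

open MeasureTheory ProbabilityTheory
open scoped NNReal Matrix

noncomputable section

/-- Rooted coloured trees: `node k [ι₁, …, ι_ℓ]` is `[ι₁, …, ι_ℓ]_k`, the tree obtained by joining
`ι₁, …, ι_ℓ` to a common root of colour `k`; `node k []` is the one-node tree `τ_k`.
Colour `0` is deterministic (`dt`), colour `1` is stochastic (`dW`). The children are listed in some
order; everything below is independent of that order. -/
inductive ColouredTree : Type
  | node (k : Fin 2) (children : List ColouredTree) : ColouredTree

namespace ColouredTree

/-- The colour of the root; `ι ∈ Γ_k` means `ι.rootColour = k`. -/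
def rootColour : ColouredTree → Fin 2
  | node k _ => k

/-- The number of nodes of colour `c`. -/
def count (c : Fin 2) : ColouredTree → ℕ
  | node k l => (if k = c then 1 else 0) + (l.map fun t => count c t).sum

/-- The order `n₀ + n₁ / 2`, where `n_c` is the number of nodes of colour `c`. -/
def ord (t : ColouredTree) : ℝ := t.count 0 + t.count 1 / 2

end ColouredTree

/-- The coefficients of an `s`-stage stochastic Runge-Kutta method. -/
structure SRKMethod (s : ℕ) where
  A : Matrix (Fin s) (Fin s) ℝ
  B : Matrix (Fin s) (Fin s) ℝ
  α : Fin s → ℝ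
  β : Fin s → ℝ

namespace SRKMethod

variable {s : ℕ} (M : SRKMethod s)

/-- `A` and `B` are strictly lower triangular. -/
def IsExplicit : Prop := ∀ i j, i ≤ j → M.A i j = 0 ∧ M.B i j = 0

/-- `A` for colour `0`, `B` for colour `1`. -/
def coeffMatrix (k : Fin 2) : Matrix (Fin s) (Fin s) ℝ := if k = 0 then M.A else M.B

/-- The elementary weight vector: `Φ(τ_k) = e` and `Φ([ι₁, …, ι_ℓ]_k)` is the componentwise product
of the vectors `Z_j Φ(ι_j)`, where `Z_j` is `A` or `B` according to the root colour of `ι_j`. -/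
def Φ : ColouredTree → Fin s → ℝ
  | .node _ l => (l.map fun t => M.coeffMatrix t.rootColour *ᵥ Φ t).prod

/-- `M⁰ = diag(α) A + Aᵀ diag(α) - α αᵀ`. -/
def M0 : Matrix (Fin s) (Fin s) ℝ :=
  Matrix.diagonal M.α * M.A + M.Aᵀ * Matrix.diagonal M.α - Matrix.vecMulVec M.α M.α

/-- `M¹ = diag(β) B + Bᵀ diag(β) - β βᵀ`. -/
def M1 : Matrix (Fin s) (Fin s) ℝ :=
  Matrix.diagonal M.β * M.B + M.Bᵀ * Matrix.diagonal M.β - Matrix.vecMulVec M.β M.β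

/-- `M* = diag(α) B + Aᵀ diag(β) - α βᵀ`. -/
def Mstar : Matrix (Fin s) (Fin s) ℝ :=
  Matrix.diagonal M.α * M.B + M.Aᵀ * Matrix.diagonal M.β - Matrix.vecMulVec M.α M.β

/-- `y 0, …, y N` are produced, with stage values `Y n 0, …, Y n (s - 1)`, by `N` steps of the method
for `dy = f(y) dt + g(y) ∘ dW` with step size `h` and increments `ΔW n`. -/
structure IsNumericalSolution {d : ℕ}
    (f g : EuclideanSpace ℝ (Fin d) → EuclideanSpace ℝ (Fin d)) (h : ℝ) (ΔW : ℕ → ℝ) (N : ℕ)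
    (Y : ℕ → Fin s → EuclideanSpace ℝ (Fin d)) (y : ℕ → EuclideanSpace ℝ (Fin d)) : Prop where
  stage : ∀ n < N, ∀ i, Y n i =
    y n + h • ∑ j, M.A i j • f (Y n j) + ΔW n • ∑ j, M.B i j • g (Y n j)
  step : ∀ n < N, y (n + 1) =
    y n + h • ∑ i, M.α i • f (Y n i) + ΔW n • ∑ i, M.β i • g (Y n i)

end SRKMethod

/-- The increment `ΔW_n = W((n+1)h) - W(nh)` along the path `w`. -/
def pathIncrement (w : ℝ≥0 → ℝ) (h : ℝ≥0) (n : ℕ) : ℝ := w ((n + 1) * h) - w (n * h)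

/-- The Itô drift `f + ½ (∂g/∂y) g` of the Stratonovich equation with coefficients `f`, `g`. -/
def itoDrift {d : ℕ} (f g : EuclideanSpace ℝ (Fin d) → EuclideanSpace ℝ (Fin d))
    (y : EuclideanSpace ℝ (Fin d)) : EuclideanSpace ℝ (Fin d) :=
  f y + (1 / 2 : ℝ) • fderiv ℝ g y (g y)

/-- `I` is an invariant of `dy = f(y) dt + g(y) ∘ dW`: it is differentiable, `∇Iᵀ f = 0` and
`∇Iᵀ g = 0`. -/
def IsSDEInvariant {d : ℕ} (f g : EuclideanSpace ℝ (Fin d) → EuclideanSpace ℝ (Fin d))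
    (I : EuclideanSpace ℝ (Fin d) → ℝ) : Prop :=
  Differentiable ℝ I ∧ ∀ y, fderiv ℝ I y (f y) = 0 ∧ fderiv ℝ I y (g y) = 0

/-- `I(y) = yᵀ C y`. -/
def quadForm {d : ℕ} (C : Matrix (Fin d) (Fin d) ℝ) (y : EuclideanSpace ℝ (Fin d)) : ℝ :=
  y.ofLp ⬝ᵥ C *ᵥ y.ofLp

end

/-! The argument is pathwise. Almost surely the path is Hölder of exponent `a` for a fixed `a < 1/2`
close to `1/2`, so `R * h ^ a` is a scale `θ` with `|ΔW| ≤ θ` and `h ≤ θ ^ 2`. A coloured tree then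
has size `θ ^ weight`, the weight being twice the order. The change of `I` in one step is `O(θ ^ p)`
with `p = 2γ + 2`, and summing at most `1 / h` steps gives `h ^ (a * p - 1)`, which is at most `h ^
(γ - ε)` once `a` is close enough to `1/2`.

Local error: with `B(x, y) = xᵀ C y`, invariance says that `f(Y_i)` and `g(Y_i)` are `B`-orthogonal
to `Y_i`. Therefore `I(y_{n+1}) - I(y_n)` is exactly a bilinear expression in `h f(Y_i)` and `ΔW
g(Y_i)` with coefficient matrices `M⁰`, `M*`, `M¹` (`bilinear_step_identity`). These vectors expand
over trees as `Φ(ι)_i` times a vector independent of the stage `i` (`smul_comp`, `of_stage`), so the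
terms of the expression carry the factors `Φ(ι)ᵀ M Φ(ι')`, which vanish by hypothesis below weight
`p` (`exists_bilinear_bound`, `exists_local_error_bound`).

Boundedness: the local constants are uniform only on bounded sets, so the numerical solution must be
bounded independently of `h`. A Gronwall argument on `∑ |ΔW_n|` fails, since Hölder exponents below
`1/2` do not control that sum. Instead the leading term `b ΔW g(y)`, `b = ∑ β_i`, is removed by the
flow `φ` of `g`, as in the Doss-Sussmann transformation: `z_n = φ(-b W(nh))(y_n)`, with `W`
recentred at time `0`, moves by `O(h + ΔW_n²)` per step (`IsGlobalFlow.exists_bound`). It remains to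
bound `∑ ΔW_n²` over all uniform partitions at once (`exists_isRegularPath`). Exponential moments
and a union bound give this on a countable grid of step sizes, and Hölder continuity transfers it to
every `h`. -/

/-! ### Taylor expansion, uniformly on bounded sets -/

theorem iteratedDeriv_comp_add_smul {E G : Type*} [NormedAddCommGroup E] [NormedSpace ℝ E]
    [NormedAddCommGroup G] [NormedSpace ℝ G] {F : E → G} (hF : ContDiff ℝ (⊤ : ℕ∞) F)
    (y u : E) (k : ℕ) :
    iteratedDeriv k (fun t : ℝ => F (y + t • u)) =
      fun t => iteratedFDeriv ℝ k F (y + t • u) (fun _ => u) := by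
  induction k with
  | zero => ext t; simp
  | succ k ih =>
    rw [iteratedDeriv_succ, ih]
    ext t
    have h1 : HasDerivAt (fun t : ℝ => y + t • u) u t := by
      simpa using ((hasDerivAt_id t).smul_const u).const_add y
    have h2 : DifferentiableAt ℝ (iteratedFDeriv ℝ k F) (y + t • u) :=
      (hF.differentiable_iteratedFDeriv (by exact_mod_cast ENat.natCast_lt_top k)) _
    have h3 := h2.hasFDerivAt.comp_hasDerivAt t h1
    have h4 := (ContinuousMultilinearMap.apply ℝ (fun _ : Fin k => E) G
      (fun _ => u)).hasFDerivAt.comp_hasDerivAt t h3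
    have h5 := h4.deriv
    rw [iteratedFDeriv_succ_apply_left]
    exact h5

theorem exists_taylor_bound {E G : Type*} [NormedAddCommGroup E] [NormedSpace ℝ E] [ProperSpace E]
    [NormedAddCommGroup G] [NormedSpace ℝ G] {F : E → G} (hF : ContDiff ℝ (⊤ : ℕ∞) F)
    (R : ℝ) (p : ℕ) :
    ∃ K : ℝ, 0 ≤ K ∧ ∀ y u : E, ‖y‖ ≤ R → ‖u‖ ≤ R →
      ‖F (y + u) - ∑ k ∈ Finset.range p, ((Nat.factorial k : ℝ)⁻¹) •
        iteratedFDeriv ℝ k F y (fun _ => u)‖ ≤ K * ‖u‖ ^ p := by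
  obtain ⟨C, hC⟩ := (isCompact_closedBall (0 : E) (R + R)).exists_bound_of_continuousOn
    (hF.continuous_iteratedFDeriv (m := p) (by exact_mod_cast le_top)).continuousOn
  refine ⟨|C|, abs_nonneg _, fun y u hy hu => ?_⟩
  have hmem : ∀ t ∈ Set.Icc (0 : ℝ) 1, y + t • u ∈ Metric.closedBall (0 : E) (R + R) := by
    intro t ht
    rw [mem_closedBall_zero_iff]
    refine (norm_add_le _ _).trans (add_le_add hy ?_)
    rw [norm_smul, Real.norm_of_nonneg ht.1]
    nlinarith [norm_nonneg u, ht.2]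
  cases p with
  | zero =>
    have := hC _ (hmem 1 (by simp))
    simp only [one_smul, norm_iteratedFDeriv_zero] at this
    simpa using this.trans (le_abs_self C)
  | succ n =>
    have hφ : ContDiff ℝ (⊤ : ℕ∞) (fun t : ℝ => F (y + t • u)) := by fun_prop
    have hd : ∀ k, ∀ t ∈ Set.Icc (0 : ℝ) 1,
        iteratedDerivWithin k (fun t : ℝ => F (y + t • u)) (Set.Icc 0 1) t =
          iteratedFDeriv ℝ k F (y + t • u) (fun _ => u) := by
      intro k t ht
      rw [iteratedDerivWithin_eq_iteratedDeriv (uniqueDiffOn_Icc_zero_one)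
        ((hφ.of_le (by exact_mod_cast le_top)).contDiffAt) ht, iteratedDeriv_comp_add_smul hF]
    have := taylor_mean_remainder_bound (f := fun t : ℝ => F (y + t • u)) (a := 0) (b := 1) (x := 1)
      (n := n) (C := |C| * ‖u‖ ^ (n + 1)) zero_le_one
      ((hφ.of_le (by exact_mod_cast le_top)).contDiffOn) (by simp) (by
        intro t ht
        rw [hd _ t ht]
        refine (ContinuousMultilinearMap.le_opNorm _ _).trans ?_
        simp only [Finset.prod_const, Finset.card_univ, Fintype.card_fin]
        gcongr
        exact (hC _ (hmem t ht)).trans (le_abs_self C))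
    rw [taylor_within_apply] at this
    simp only [sub_zero, one_pow, mul_one, one_smul] at this
    rw [Finset.sum_congr rfl (fun k _ => by rw [hd k 0 (by simp)])] at this
    simp only [zero_smul, add_zero] at this
    refine this.trans (div_le_self (by positivity) ?_)
    exact_mod_cast Nat.succ_le_of_lt (Nat.factorial_pos n)

theorem exists_lipschitz_bound {E G : Type*} [NormedAddCommGroup E] [NormedSpace ℝ E]
    [ProperSpace E] [NormedAddCommGroup G] [NormedSpace ℝ G] {F : E → G}
    (hF : ContDiff ℝ (⊤ : ℕ∞) F) (R : ℝ) :
    ∃ K : ℝ, 0 ≤ K ∧ ∀ x y : E, ‖x‖ ≤ R → ‖y‖ ≤ R → ‖F x - F y‖ ≤ K * ‖x - y‖ := by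
  obtain ⟨C, hC⟩ := (isCompact_closedBall (0 : E) R).exists_bound_of_continuousOn
    (hF.continuous_fderiv (by simp)).continuousOn
  refine ⟨|C|, abs_nonneg _, fun x y hx hy => ?_⟩
  exact (convex_closedBall (0 : E) R).norm_image_sub_le_of_norm_fderiv_le
    (fun z _ => (hF.differentiable (by simp)) z) (fun z hz => (hC z hz).trans (le_abs_self C))
    (by simpa using hy) (by simpa using hx)

/-! ### Expansions indexed by coloured trees -/

namespace ColouredTree

/-- Twice the order. -/
def weight (t : ColouredTree) : ℕ := 2 * t.count 0 + t.count 1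

theorem two_mul_ord (t : ColouredTree) : 2 * t.ord = t.weight := by
  simp only [ord, weight]; push_cast; ring

/-- The contribution of a root of colour `k` to the weight. -/
def rootWeight (k : Fin 2) : ℕ := if k = 0 then 2 else 1

theorem weight_node (k : Fin 2) (l : List ColouredTree) :
    (node k l).weight = rootWeight k + (l.map weight).sum := by
  have h : (l.map weight).sum = 2 * (l.map (count 0)).sum + (l.map (count 1)).sum := by
    induction l with
    | nil => simp
    | cons a l ih => simp only [List.map_cons, List.sum_cons, ih, weight]; ring
  rw [h]
  fin_cases k <;> simp [weight, count, rootWeight] <;> ring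

theorem rootWeight_pos (k : Fin 2) : 0 < rootWeight k := by
  unfold rootWeight; split_ifs <;> norm_num

theorem weight_pos (t : ColouredTree) : 0 < t.weight := by
  cases t with
  | node k l =>
    rw [weight_node]
    exact Nat.add_pos_left (rootWeight_pos k) _

end ColouredTree

/-- `X x i = ∑ₐ Ψ (τ a) i • v a x + O(θ x ^ p)` for finitely many trees `τ a` satisfying `S`, with
`v a x = O(θ x ^ weight (τ a))` independent of the index `i`. -/
def HasTreeExpansion {s : ℕ} {𝒟 G : Type*} [NormedAddCommGroup G] [NormedSpace ℝ G] (θ : 𝒟 → ℝ)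
    (Ψ : ColouredTree → Fin s → ℝ) (S : ColouredTree → Prop) (p : ℕ) (X : 𝒟 → Fin s → G) : Prop :=
  ∃ (ι : Type) (_ : Fintype ι) (τ : ι → ColouredTree) (v : ι → 𝒟 → G),
    (∀ a, S (τ a)) ∧ (∀ a, ∃ K, ∀ x, ‖v a x‖ ≤ K * θ x ^ (τ a).weight) ∧
    ∃ K, ∀ x i, ‖X x i - ∑ a, Ψ (τ a) i • v a x‖ ≤ K * θ x ^ p

namespace SRKMethod

theorem Φ_node_ofFn {s : ℕ} (M : SRKMethod s) (k : Fin 2) {l : ℕ} (τ : Fin l → ColouredTree)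
    (i : Fin s) :
    M.Φ (.node k (List.ofFn τ)) i =
      ∏ m, (M.coeffMatrix (τ m).rootColour *ᵥ M.Φ (τ m)) i := by
  rw [SRKMethod.Φ, List.map_ofFn, List.prod_ofFn, Finset.prod_apply]
  rfl

end SRKMethod

namespace HasTreeExpansion

variable {s : ℕ} {𝒟 G : Type*} [NormedAddCommGroup G] [NormedSpace ℝ G] {θ : 𝒟 → ℝ} {Θ : ℝ}

/-- Every tree has weight at least one, so one factor `θ` can be split off and the remaining powers
bounded by powers of `|Θ|`. -/
theorem exists_norm_sum_le {Ψ : ColouredTree → Fin s → ℝ} (hθ0 : ∀ x, 0 ≤ θ x) (hθ : ∀ x, θ x ≤ Θ)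
    {ι : Type} [Fintype ι] {τ : ι → ColouredTree} {v : ι → 𝒟 → G}
    (hv : ∀ a, ∃ K, ∀ x, ‖v a x‖ ≤ K * θ x ^ (τ a).weight) :
    ∃ K, 0 ≤ K ∧ ∀ x i, ‖∑ a, Ψ (τ a) i • v a x‖ ≤ K * θ x := by
  choose K hK using hv
  refine ⟨∑ a, ∑ i, |Ψ (τ a) i| * (|K a| * |Θ| ^ ((τ a).weight - 1)), by positivity, ?_⟩
  intro x i
  rw [Finset.sum_mul]
  refine (norm_sum_le _ _).trans (Finset.sum_le_sum fun a _ => ?_)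
  have h1 : ‖v a x‖ ≤ |K a| * |Θ| ^ ((τ a).weight - 1) * θ x := by
    refine (hK a x).trans ?_
    obtain ⟨n, hn⟩ := Nat.exists_eq_succ_of_ne_zero (τ a).weight_pos.ne'
    rw [hn, Nat.succ_sub_one, pow_succ, mul_assoc]
    have := hθ0 x
    have : θ x ≤ |Θ| := (hθ x).trans (le_abs_self _)
    gcongr
    exact le_abs_self _
  rw [norm_smul, Real.norm_eq_abs]
  calc |Ψ (τ a) i| * ‖v a x‖
      ≤ |Ψ (τ a) i| * (|K a| * |Θ| ^ ((τ a).weight - 1) * θ x) := by gcongr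
    _ = |Ψ (τ a) i| * (|K a| * |Θ| ^ ((τ a).weight - 1)) * θ x := by ring
    _ ≤ _ := by
      have := hθ0 x
      gcongr
      exact Finset.single_le_sum (f := fun i => |Ψ (τ a) i| * (|K a| * |Θ| ^ ((τ a).weight - 1)))
        (fun _ _ => by positivity) (Finset.mem_univ i)

theorem mono {Ψ : ColouredTree → Fin s → ℝ} {S : ColouredTree → Prop} (hθ0 : ∀ x, 0 ≤ θ x)
    (hθ : ∀ x, θ x ≤ Θ) {p q : ℕ} (hpq : q ≤ p) {X : 𝒟 → Fin s → G}
    (hX : HasTreeExpansion θ Ψ S p X) : HasTreeExpansion θ Ψ S q X := by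
  obtain ⟨ι, hι, τ, v, hS, hv, K, hK⟩ := hX
  refine ⟨ι, hι, τ, v, hS, hv, |K| * |Θ| ^ (p - q), fun x i => (hK x i).trans ?_⟩
  obtain ⟨n, rfl⟩ := Nat.exists_eq_add_of_le hpq
  rw [Nat.add_sub_cancel_left, pow_add, mul_comm (θ x ^ q), ← mul_assoc]
  have := hθ0 x
  have : θ x ≤ |Θ| := (hθ x).trans (le_abs_self _)
  gcongr
  exact le_abs_self _

variable {E : Type*} [NormedAddCommGroup E] [NormedSpace ℝ E] [ProperSpace E]

/-- Taylor expand `F` at `y` and insert the expansion of `U`. By multilinearity of the derivatives,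
a choice of `l` trees contributes the product of the entries `(Z_j Φ(ι_j))_i`, which is `Φ` of the
tree grafted on a new root of colour `k`. The factor `c` accounts for the weight of that root. -/
theorem smul_comp (M : SRKMethod s) (hθ0 : ∀ x, 0 ≤ θ x) (hθ : ∀ x, θ x ≤ Θ) {y : 𝒟 → E} {R : ℝ}
    (hy : ∀ x, ‖y x‖ ≤ R) {U : 𝒟 → Fin s → E} {p : ℕ} {S : ColouredTree → Prop}
    (hU : HasTreeExpansion θ (fun t => M.coeffMatrix t.rootColour *ᵥ M.Φ t) S p U)
    {F : E → G} (hF : ContDiff ℝ (⊤ : ℕ∞) F) {c : 𝒟 → ℝ} {k : Fin 2}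
    (hc : ∃ K, ∀ x, |c x| ≤ K * θ x ^ ColouredTree.rootWeight k) :
    HasTreeExpansion θ M.Φ (fun t => t.rootColour = k) (p + ColouredTree.rootWeight k)
      (fun x i => c x • F (y x + U x i)) := by
  classical
  obtain ⟨ι, hι, τ, v, -, hv, K, hK⟩ := hU
  obtain ⟨Kc, hKc⟩ := hc
  obtain ⟨K₁, hK₁0, hK₁⟩ := exists_norm_sum_le
    (Ψ := fun t => M.coeffMatrix t.rootColour *ᵥ M.Φ t) hθ0 hθ hv
  choose Kv hKv using hv
  set u : 𝒟 → Fin s → E :=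
    fun x i => ∑ a, (M.coeffMatrix (τ a).rootColour *ᵥ M.Φ (τ a)) i • v a x with hu
  have hθ' : ∀ x, θ x ≤ |Θ| := fun x => (hθ x).trans (le_abs_self _)
  set R' := |R| + K₁ * |Θ| + |K| * |Θ| ^ p with hR'
  have hR0 : 0 ≤ |K| * |Θ| ^ p := by positivity
  have hub : ∀ x i, ‖u x i‖ ≤ K₁ * |Θ| := fun x i =>
    (hK₁ x i).trans (mul_le_mul_of_nonneg_left (hθ' x) hK₁0)
  have hU' : ∀ x i, ‖U x i - u x i‖ ≤ |K| * θ x ^ p := fun x i =>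
    (hK x i).trans (mul_le_mul_of_nonneg_right (le_abs_self _) (pow_nonneg (hθ0 x) _))
  have hyb : ∀ x, ‖y x‖ ≤ |R| := fun x => (hy x).trans (le_abs_self _)
  have hyu : ∀ x i, ‖y x + u x i‖ ≤ R' := fun x i => by
    have := norm_add_le (y x) (u x i)
    have := hub x i
    have := hyb x
    linarith
  have hyU : ∀ x i, ‖y x + U x i‖ ≤ R' := fun x i => by
    have h1 : y x + U x i = (y x + u x i) + (U x i - u x i) := by abel
    have h2 := norm_add_le (y x + u x i) (U x i - u x i)
    have h3 := norm_add_le (y x) (u x i)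
    have := hub x i
    have := hyb x
    have h4 : ‖U x i - u x i‖ ≤ |K| * |Θ| ^ p := (hU' x i).trans (by
      have := hθ0 x
      have := hθ' x
      gcongr)
    rw [h1]
    linarith
  have hK₁Θ : 0 ≤ K₁ * |Θ| := by positivity
  -- The Lipschitz bound handles the remainder `U - u`; the Taylor bound of order `p` suffices for
  -- `u` because `u = O(θ)`.
  obtain ⟨KL, hKL0, hKL⟩ := exists_lipschitz_bound hF R'
  obtain ⟨KT, hKT0, hKT⟩ := exists_taylor_bound hF R' p
  refine ⟨Σ l : Fin p, (Fin l → ι), inferInstance,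
    fun a => .node k (List.ofFn fun m => τ (a.2 m)),
    fun a x => c x • ((Nat.factorial a.1 : ℝ)⁻¹ •
      iteratedFDeriv ℝ a.1 F (y x) (fun m => v (a.2 m) x)), fun a => rfl, ?_, ?_⟩
  · rintro ⟨l, r⟩
    obtain ⟨C, hC⟩ := (isCompact_closedBall (0 : E) R).exists_bound_of_continuousOn
      (hF.continuous_iteratedFDeriv (m := (l : ℕ)) (by exact_mod_cast le_top)).continuousOn
    refine ⟨|Kc| * ((Nat.factorial l : ℝ)⁻¹ * (|C| * ∏ m, |Kv (r m)|)), fun x => ?_⟩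
    have hpos := hθ0 x
    have h1 : |c x| ≤ |Kc| * θ x ^ ColouredTree.rootWeight k :=
      (hKc x).trans (by gcongr; exact le_abs_self _)
    have h2 : ‖iteratedFDeriv ℝ l F (y x) (fun m => v (r m) x)‖ ≤
        |C| * ∏ m, (|Kv (r m)| * θ x ^ (τ (r m)).weight) := by
      refine (ContinuousMultilinearMap.le_opNorm _ _).trans ?_
      gcongr with m
      · exact (hC _ (by simpa using hy x)).trans (le_abs_self _)
      · exact (hKv _ x).trans (by gcongr; exact le_abs_self _)
    rw [ColouredTree.weight_node, List.map_ofFn, List.sum_ofFn, norm_smul, norm_smul,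
      Real.norm_eq_abs, Real.norm_of_nonneg (by positivity : (0 : ℝ) ≤ (Nat.factorial l : ℝ)⁻¹)]
    calc _ ≤ (|Kc| * θ x ^ ColouredTree.rootWeight k) * ((Nat.factorial l : ℝ)⁻¹ *
          (|C| * ∏ m, (|Kv (r m)| * θ x ^ (τ (r m)).weight))) := by gcongr
      _ = _ := by
        rw [Finset.prod_mul_distrib, Finset.prod_pow_eq_pow_sum, pow_add]
        simp only [Function.comp_def]
        ring
  · refine ⟨|Kc| * (KL * |K| + KT * K₁ ^ p), fun x i => ?_⟩
    have hsum : ∑ a : (Σ l : Fin p, (Fin l → ι)),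
        M.Φ (.node k (List.ofFn fun m => τ (a.2 m))) i • (c x • ((Nat.factorial a.1 : ℝ)⁻¹ •
          iteratedFDeriv ℝ a.1 F (y x) (fun m => v (a.2 m) x))) =
        c x • ∑ l ∈ Finset.range p, (Nat.factorial l : ℝ)⁻¹ •
          iteratedFDeriv ℝ l F (y x) (fun _ => u x i) := by
      rw [Fintype.sum_sigma, Finset.sum_range, Finset.smul_sum]
      refine Finset.sum_congr rfl fun l _ => ?_
      simp only [hu]
      rw [ContinuousMultilinearMap.map_sum, Finset.smul_sum, Finset.smul_sum]
      refine Finset.sum_congr rfl fun r _ => ?_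
      rw [ContinuousMultilinearMap.map_smul_univ, SRKMethod.Φ_node_ofFn, smul_comm _ (c x),
        smul_comm _ ((Nat.factorial l : ℝ)⁻¹)]
    rw [hsum, ← smul_sub, norm_smul, Real.norm_eq_abs]
    have hpos := hθ0 x
    have h1 : |c x| ≤ |Kc| * θ x ^ ColouredTree.rootWeight k :=
      (hKc x).trans (by gcongr; exact le_abs_self _)
    have h2 : ‖F (y x + U x i) - F (y x + u x i)‖ ≤ KL * |K| * θ x ^ p := by
      refine (hKL _ _ (hyU x i) (hyu x i)).trans ?_
      rw [add_sub_add_left_eq_sub, mul_assoc]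
      exact mul_le_mul_of_nonneg_left (hU' x i) hKL0
    have h3 := hKT (y x) (u x i) ((hyb x).trans (by linarith)) ((hub x i).trans (by
      have := abs_nonneg R; linarith))
    have h4 : KT * ‖u x i‖ ^ p ≤ KT * K₁ ^ p * θ x ^ p := by
      rw [mul_assoc, ← mul_pow]
      gcongr
      exact hK₁ x i
    have h5 := norm_add_le (F (y x + U x i) - F (y x + u x i)) (F (y x + u x i) -
      ∑ l ∈ Finset.range p, (Nat.factorial l : ℝ)⁻¹ •
          iteratedFDeriv ℝ l F (y x) (fun _ => u x i))
    rw [sub_add_sub_cancel] at h5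
    calc _ ≤ (|Kc| * θ x ^ ColouredTree.rootWeight k) *
          (KL * |K| * θ x ^ p + KT * K₁ ^ p * θ x ^ p) := by
          gcongr
          linarith
      _ = _ := by rw [pow_add]; ring

end HasTreeExpansion

namespace HasTreeExpansion

variable {s : ℕ} {𝒟 : Type*} {θ : 𝒟 → ℝ} {Θ : ℝ}

theorem exists_norm_le {G : Type*} [NormedAddCommGroup G] [NormedSpace ℝ G]
    {Ψ : ColouredTree → Fin s → ℝ} {S : ColouredTree → Prop} (hθ0 : ∀ x, 0 ≤ θ x)
    (hθ : ∀ x, θ x ≤ Θ) {p : ℕ} {X : 𝒟 → Fin s → G}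
    (hX : HasTreeExpansion θ Ψ S p X) : ∃ K, 0 ≤ K ∧ ∀ x i, ‖X x i‖ ≤ K := by
  obtain ⟨ι, hι, τ, v, hS, hv, K, hK⟩ := hX
  obtain ⟨K₁, hK₁0, hK₁⟩ := exists_norm_sum_le (Ψ := Ψ) hθ0 hθ hv
  refine ⟨|K| * |Θ| ^ p + K₁ * |Θ|, by positivity, fun x i => ?_⟩
  have hθ' : θ x ≤ |Θ| := (hθ x).trans (le_abs_self _)
  have h1 := norm_add_le (X x i - ∑ a, Ψ (τ a) i • v a x) (∑ a, Ψ (τ a) i • v a x)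
  rw [sub_add_cancel] at h1
  refine h1.trans (add_le_add ((hK x i).trans ?_) ((hK₁ x i).trans ?_))
  · have := hθ0 x
    gcongr
    exact le_abs_self _
  · gcongr

variable {E : Type*} [NormedAddCommGroup E] [NormedSpace ℝ E]

theorem linear_combination (M : SRKMethod s) {p : ℕ} {X X' : 𝒟 → Fin s → E}
    (hX : HasTreeExpansion θ M.Φ (fun t => t.rootColour = 0) p X)
    (hX' : HasTreeExpansion θ M.Φ (fun t => t.rootColour = 1) p X') :
    HasTreeExpansion θ (fun t => M.coeffMatrix t.rootColour *ᵥ M.Φ t) (fun _ => True) p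
      (fun x i => ∑ j, M.A i j • X x j + ∑ j, M.B i j • X' x j) := by
  have key : ∀ {ι : Type} [Fintype ι] (Z : Matrix (Fin s) (Fin s) ℝ) (τ : ι → ColouredTree)
      (v : ι → 𝒟 → E) (X : 𝒟 → Fin s → E) (K : ℝ),
      (∀ x i, ‖X x i - ∑ a, M.Φ (τ a) i • v a x‖ ≤ K * θ x ^ p) →
      ∀ x i, ‖∑ j, Z i j • X x j - ∑ a, (Z *ᵥ M.Φ (τ a)) i • v a x‖ ≤
        (∑ i, ∑ j, |Z i j|) * K * θ x ^ p := by
    intro ι _ Z τ v X K h x i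
    have h0 : 0 ≤ K * θ x ^ p := (norm_nonneg _).trans (h x i)
    have h1 : ∑ a, (Z *ᵥ M.Φ (τ a)) i • v a x = ∑ j, Z i j • ∑ a, M.Φ (τ a) j • v a x := by
      simp only [Finset.smul_sum, smul_smul, Matrix.mulVec, dotProduct, Finset.sum_smul]
      rw [Finset.sum_comm]
    rw [h1, ← Finset.sum_sub_distrib, mul_assoc, Finset.sum_mul]
    refine (norm_sum_le _ _).trans (le_trans ?_
      (Finset.single_le_sum (f := fun i => (∑ j, |Z i j|) * (K * θ x ^ p))
        (fun _ _ => by positivity) (Finset.mem_univ i)))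
    simp only [Finset.sum_mul]
    refine Finset.sum_le_sum fun j _ => ?_
    rw [← smul_sub, norm_smul, Real.norm_eq_abs]
    exact mul_le_mul_of_nonneg_left (h x j) (abs_nonneg _)
  obtain ⟨ι, hι, τ, v, hS, hv, K, hK⟩ := hX
  obtain ⟨ι', hι', τ', v', hS', hv', K', hK'⟩ := hX'
  refine ⟨ι ⊕ ι', inferInstance, Sum.elim τ τ', Sum.elim v v', fun _ => trivial, ?_,
    (∑ i, ∑ j, |M.A i j|) * K + (∑ i, ∑ j, |M.B i j|) * K', fun x i => ?_⟩
  · rintro (a | a)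
    · exact hv a
    · exact hv' a
  · have e1 : ∀ a, M.coeffMatrix (τ a).rootColour = M.A := fun a => by
      rw [hS a]; simp [SRKMethod.coeffMatrix]
    have e2 : ∀ a, M.coeffMatrix (τ' a).rootColour = M.B := fun a => by
      rw [hS' a]; simp [SRKMethod.coeffMatrix]
    rw [Fintype.sum_sum_type]
    simp only [Sum.elim_inl, Sum.elim_inr, e1, e2]
    rw [add_sub_add_comm, add_mul]
    exact (norm_add_le _ _).trans (add_le_add (key M.A τ v X K hK x i) (key M.B τ' v' X' K' hK' x i))

/-- Bootstrap on the implicit stage equation: an expansion of `U` to order `p`, inserted in the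
right-hand side, gains at least one power of `θ` from `h` or `w`. Only an a priori bound on `U` is
needed, so implicit methods are covered. -/
theorem of_stage [ProperSpace E] (M : SRKMethod s) (hθ0 : ∀ x, 0 ≤ θ x) (hθ : ∀ x, θ x ≤ Θ)
    {y : 𝒟 → E} {R : ℝ} (hy : ∀ x, ‖y x‖ ≤ R) {U : 𝒟 → Fin s → E} (hUb : ∀ x i, ‖U x i‖ ≤ R)
    {f g : E → E} (hf : ContDiff ℝ (⊤ : ℕ∞) f) (hg : ContDiff ℝ (⊤ : ℕ∞) g)
    {h w : 𝒟 → ℝ} (hh : ∀ x, |h x| ≤ θ x ^ 2) (hw : ∀ x, |w x| ≤ θ x)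
    (hU : ∀ x i, U x i = h x • ∑ j, M.A i j • f (y x + U x j) +
      w x • ∑ j, M.B i j • g (y x + U x j)) (p : ℕ) :
    HasTreeExpansion θ (fun t => M.coeffMatrix t.rootColour *ᵥ M.Φ t) (fun _ => True) p U := by
  induction p with
  | zero =>
    -- At order zero no tree is needed: boundedness alone is the claim.
    exact ⟨Empty, inferInstance, Empty.elim, Empty.elim, fun a => a.elim, fun a => a.elim, R,
      fun x i => by simpa using hUb x i⟩
  | succ p ih =>
    have h0 := ((smul_comp M hθ0 hθ hy ih hf (c := h) (k := 0)
      ⟨1, fun x => by simpa [ColouredTree.rootWeight] using hh x⟩).mono hθ0 hθ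
      (q := p + 1) (by simp [ColouredTree.rootWeight]))
    have h1 := ((smul_comp M hθ0 hθ hy ih hg (c := w) (k := 1)
      ⟨1, fun x => by simpa [ColouredTree.rootWeight] using hw x⟩).mono hθ0 hθ
      (q := p + 1) (by simp [ColouredTree.rootWeight]))
    convert linear_combination M h0 h1 using 3 with x i
    rw [hU x i]
    simp only [Finset.smul_sum, smul_comm (h x), smul_comm (w x)]

/-- The tree vectors do not depend on the stage, so the double sum over stages factors as `Φᵀ m Φ'`
times a scalar. Pairs of total weight below `p` vanish by `hm`; the others are already `O(θ ^ p)`.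
-/
theorem exists_bilinear_bound (M : SRKMethod s) (hθ0 : ∀ x, 0 ≤ θ x) (hθ : ∀ x, θ x ≤ Θ)
    (B : E →L[ℝ] E →L[ℝ] ℝ) (m : Matrix (Fin s) (Fin s) ℝ) {p : ℕ} {S S' : ColouredTree → Prop}
    {X X' : 𝒟 → Fin s → E}
    (hX : HasTreeExpansion θ M.Φ S p X) (hX' : HasTreeExpansion θ M.Φ S' p X')
    (hm : ∀ t t', S t → S' t' → t.weight + t'.weight < p → M.Φ t ⬝ᵥ m *ᵥ M.Φ t' = 0) :
    ∃ K, 0 ≤ K ∧ ∀ x, |∑ i, ∑ j, m i j * B (X x i) (X' x j)| ≤ K * θ x ^ p := by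
  obtain ⟨C', hC'0, hC'⟩ := hX'.exists_norm_le hθ0 hθ
  obtain ⟨ι, hι, τ, v, hS, hv, K, hK⟩ := hX
  obtain ⟨ι', hι', τ', v', hS', hv', K', hK'⟩ := hX'
  obtain ⟨C, hC0, hC⟩ := exists_norm_sum_le (Ψ := M.Φ) hθ0 hθ hv
  choose Kv hKv using hv
  choose Kv' hKv' using hv'
  set u : 𝒟 → Fin s → E := fun x i => ∑ a, M.Φ (τ a) i • v a x with hu
  set u' : 𝒟 → Fin s → E := fun x i => ∑ a, M.Φ (τ' a) i • v' a x with hu'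
  have hterm : ∀ a b, ∃ K, 0 ≤ K ∧ ∀ x, |(M.Φ (τ a) ⬝ᵥ m *ᵥ M.Φ (τ' b)) * B (v a x) (v' b x)| ≤
      K * θ x ^ p := by
    intro a b
    by_cases hlt : (τ a).weight + (τ' b).weight < p
    · exact ⟨0, le_rfl, fun x => by simp [hm _ _ (hS a) (hS' b) hlt]⟩
    · obtain ⟨n, hn⟩ := Nat.exists_eq_add_of_le (not_lt.1 hlt)
      refine ⟨|M.Φ (τ a) ⬝ᵥ m *ᵥ M.Φ (τ' b)| * (‖B‖ * |Kv a| * |Kv' b| * |Θ| ^ n), by positivity,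
        fun x => ?_⟩
      have hpos := hθ0 x
      have hle : θ x ≤ |Θ| := (hθ x).trans (le_abs_self _)
      rw [abs_mul, mul_assoc]
      gcongr
      calc |B (v a x) (v' b x)| ≤ ‖B‖ * ‖v a x‖ * ‖v' b x‖ := B.le_opNorm₂ _ _
        _ ≤ ‖B‖ * (|Kv a| * θ x ^ (τ a).weight) * (|Kv' b| * θ x ^ (τ' b).weight) := by
          gcongr
          · exact (hKv a x).trans (by gcongr; exact le_abs_self _)
          · exact (hKv' b x).trans (by gcongr; exact le_abs_self _)
        _ = ‖B‖ * |Kv a| * |Kv' b| * θ x ^ ((τ a).weight + (τ' b).weight) := by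
          rw [pow_add]; ring
        _ = ‖B‖ * |Kv a| * |Kv' b| * θ x ^ n * θ x ^ p := by
          rw [hn, pow_add]; ring
        _ ≤ _ := by gcongr
  choose KK hKK0 hKK using hterm
  refine ⟨(∑ i, ∑ j, |m i j| * (‖B‖ * |K| * C' + ‖B‖ * (C * |Θ|) * |K'|)) + ∑ a, ∑ b, KK a b,
    add_nonneg (by positivity) (Finset.sum_nonneg fun a _ => Finset.sum_nonneg fun b _ => hKK0 a b),
    fun x => ?_⟩
  have hpos := hθ0 x
  have hle : θ x ≤ |Θ| := (hθ x).trans (le_abs_self _)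
  have hmain : ∑ i, ∑ j, m i j * B (u x i) (u' x j) =
      ∑ a, ∑ b, (M.Φ (τ a) ⬝ᵥ m *ᵥ M.Φ (τ' b)) * B (v a x) (v' b x) := by
    have e : ∀ i j, m i j * B (u x i) (u' x j) =
        ∑ a, ∑ b, M.Φ (τ a) i * (m i j * M.Φ (τ' b) j) * B (v a x) (v' b x) := by
      intro i j
      simp only [hu, hu', map_sum, map_smul, sum_apply,
        smul_apply, smul_eq_mul, Finset.mul_sum]
      rw [Finset.sum_comm]
      exact Finset.sum_congr rfl fun a _ => Finset.sum_congr rfl fun b _ => by ring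
    simp only [e, dotProduct, Matrix.mulVec, Finset.mul_sum, Finset.sum_mul]
    have e1 : ∀ i, ∑ j, ∑ a, ∑ b, M.Φ (τ a) i * (m i j * M.Φ (τ' b) j) * B (v a x) (v' b x) =
        ∑ a, ∑ b, ∑ j, M.Φ (τ a) i * (m i j * M.Φ (τ' b) j) * B (v a x) (v' b x) := by
      intro i
      rw [Finset.sum_comm]
      exact Finset.sum_congr rfl fun a _ => Finset.sum_comm
    simp only [e1]
    rw [Finset.sum_comm]
    exact Finset.sum_congr rfl fun a _ => Finset.sum_comm
  have hsplit : ∑ i, ∑ j, m i j * B (X x i) (X' x j) =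
      ∑ i, ∑ j, m i j * (B (X x i - u x i) (X' x j) + B (u x i) (X' x j - u' x j)) +
        ∑ i, ∑ j, m i j * B (u x i) (u' x j) := by
    simp only [← Finset.sum_add_distrib]
    refine Finset.sum_congr rfl fun i _ => Finset.sum_congr rfl fun j _ => ?_
    simp only [map_sub, sub_apply]
    ring
  rw [hsplit, hmain, add_mul]
  refine (abs_add_le _ _).trans (add_le_add ?_ ?_)
  · simp only [Finset.sum_mul]
    refine (Finset.abs_sum_le_sum_abs _ _).trans (Finset.sum_le_sum fun i _ => ?_)
    refine (Finset.abs_sum_le_sum_abs _ _).trans (Finset.sum_le_sum fun j _ => ?_)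
    rw [abs_mul, mul_assoc]
    gcongr
    refine (abs_add_le _ _).trans ?_
    rw [add_mul]
    refine add_le_add ?_ ?_
    · calc |B (X x i - u x i) (X' x j)| ≤ ‖B‖ * ‖X x i - u x i‖ * ‖X' x j‖ := B.le_opNorm₂ _ _
        _ ≤ ‖B‖ * (|K| * θ x ^ p) * C' := by
          gcongr
          · exact (hK x i).trans (by gcongr; exact le_abs_self _)
          · exact hC' x j
        _ = _ := by ring
    · calc |B (u x i) (X' x j - u' x j)| ≤ ‖B‖ * ‖u x i‖ * ‖X' x j - u' x j‖ := B.le_opNorm₂ _ _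
        _ ≤ ‖B‖ * (C * |Θ|) * (|K'| * θ x ^ p) := by
          gcongr
          · exact (hC x i).trans (by gcongr)
          · exact (hK' x j).trans (by gcongr; exact le_abs_self _)
        _ = _ := by ring
  · simp only [Finset.sum_mul]
    refine (Finset.abs_sum_le_sum_abs _ _).trans (Finset.sum_le_sum fun a _ => ?_)
    exact (Finset.abs_sum_le_sum_abs _ _).trans (Finset.sum_le_sum fun b _ => hKK a b x)

end HasTreeExpansion

/-! ### The local error of a quadratic invariant -/

/-- The bilinear form `(x, y) ↦ xᵀ C y`. -/
noncomputable def matrixBilin {d : ℕ} (C : Matrix (Fin d) (Fin d) ℝ) :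
    EuclideanSpace ℝ (Fin d) →L[ℝ] EuclideanSpace ℝ (Fin d) →L[ℝ] ℝ :=
  (innerSL ℝ).bilinearComp (ContinuousLinearMap.id ℝ _) (Matrix.toEuclideanCLM (𝕜 := ℝ) C)

theorem matrixBilin_apply {d : ℕ} (C : Matrix (Fin d) (Fin d) ℝ) (x y : EuclideanSpace ℝ (Fin d)) :
    matrixBilin C x y = x.ofLp ⬝ᵥ C *ᵥ y.ofLp := by
  simp [matrixBilin, EuclideanSpace.inner_eq_star_dotProduct, dotProduct_comm]

theorem matrixBilin_symm {d : ℕ} {C : Matrix (Fin d) (Fin d) ℝ} (hC : C.IsSymm)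
    (x y : EuclideanSpace ℝ (Fin d)) : matrixBilin C x y = matrixBilin C y x := by
  rw [matrixBilin_apply, matrixBilin_apply, Matrix.dotProduct_mulVec, ← Matrix.mulVec_transpose, hC,
    dotProduct_comm]

theorem quadForm_eq_matrixBilin {d : ℕ} (C : Matrix (Fin d) (Fin d) ℝ)
    (y : EuclideanSpace ℝ (Fin d)) : quadForm C y = matrixBilin C y y :=
  (matrixBilin_apply C y y).symm

theorem fderiv_quadForm {d : ℕ} {C : Matrix (Fin d) (Fin d) ℝ} (hC : C.IsSymm)
    (y v : EuclideanSpace ℝ (Fin d)) : fderiv ℝ (quadForm C) y v = 2 * matrixBilin C y v := by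
  have h : HasFDerivAt (fun y => matrixBilin C y y) _ y :=
    (matrixBilin C).hasFDerivAt_of_bilinear (hasFDerivAt_id y) (hasFDerivAt_id y)
  have e : quadForm C = fun y => matrixBilin C y y := funext (quadForm_eq_matrixBilin C)
  rw [e, h.fderiv]
  simp [ContinuousLinearMap.precompR, ContinuousLinearMap.precompL, matrixBilin_symm hC v y]
  ring

namespace SRKMethod

variable {s : ℕ} (M : SRKMethod s)

/-- Expanding `B y₁ y₁` leaves the linear terms `B y (F i)` and `B y (G i)`. Orthogonality at the
stages together with the stage equations rewrites these as sums of the `B (F i) (F j)`, `B (F i) (G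
j)` and `B (G i) (G j)`. Symmetrising then produces the three matrices. -/
theorem bilinear_step_identity {E : Type*} [NormedAddCommGroup E] [NormedSpace ℝ E]
    (B : E →L[ℝ] E →L[ℝ] ℝ) (hB : ∀ x y, B x y = B y x) {y y₁ : E} {Y F G : Fin s → E}
    (hY : ∀ i, Y i = y + ∑ j, M.A i j • F j + ∑ j, M.B i j • G j)
    (hy₁ : y₁ = y + ∑ i, M.α i • F i + ∑ i, M.β i • G i)
    (hF : ∀ i, B (Y i) (F i) = 0) (hG : ∀ i, B (Y i) (G i) = 0) :
    B y₁ y₁ - B y y = -(∑ i, ∑ j, M.M0 i j * B (F i) (F j) +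
      2 * ∑ i, ∑ j, M.Mstar i j * B (F i) (G j) + ∑ i, ∑ j, M.M1 i j * B (G i) (G j)) := by
  have hyF : ∀ i, B y (F i) =
      -(∑ j, M.A i j * B (F i) (F j) + ∑ j, M.B i j * B (F i) (G j)) := by
    intro i
    have := hF i
    rw [hB, hY i] at this
    simp only [map_add, map_sum, map_smul, smul_eq_mul] at this
    rw [hB y]
    linarith
  have hyG : ∀ i, B y (G i) =
      -(∑ j, M.A i j * B (F j) (G i) + ∑ j, M.B i j * B (G i) (G j)) := by
    intro i
    have := hG i
    rw [hB, hY i] at this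
    simp only [map_add, map_sum, map_smul, smul_eq_mul] at this
    rw [hB y]
    simp only [hB (F _) (G i)]
    linarith
  have hL : B y₁ y₁ - B y y = 2 * (∑ i, M.α i * B y (F i) + ∑ i, M.β i * B y (G i)) +
      (∑ i, ∑ j, M.α i * M.α j * B (F i) (F j) + 2 * ∑ i, ∑ j, M.α i * M.β j * B (F i) (G j) +
        ∑ i, ∑ j, M.β i * M.β j * B (G i) (G j)) := by
    set a := ∑ i, M.α i • F i with ha
    set b := ∑ i, M.β i • G i with hb
    have e1 : B y a = ∑ i, M.α i * B y (F i) := by simp [ha]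
    have e2 : B y b = ∑ i, M.β i * B y (G i) := by simp [hb]
    have e3 : B a a = ∑ i, ∑ j, M.α i * M.α j * B (F i) (F j) := by
      simp only [ha, map_sum, map_smul, sum_apply, smul_apply, smul_eq_mul, Finset.mul_sum]
      rw [Finset.sum_comm]
      exact Finset.sum_congr rfl fun _ _ => Finset.sum_congr rfl fun _ _ => by ring
    have e4 : B a b = ∑ i, ∑ j, M.α i * M.β j * B (F i) (G j) := by
      simp only [ha, hb, map_sum, map_smul, sum_apply, smul_apply, smul_eq_mul, Finset.mul_sum]
      rw [Finset.sum_comm]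
      exact Finset.sum_congr rfl fun _ _ => Finset.sum_congr rfl fun _ _ => by ring
    have e5 : B b b = ∑ i, ∑ j, M.β i * M.β j * B (G i) (G j) := by
      simp only [hb, map_sum, map_smul, sum_apply, smul_apply, smul_eq_mul, Finset.mul_sum]
      rw [Finset.sum_comm]
      exact Finset.sum_congr rfl fun _ _ => Finset.sum_congr rfl fun _ _ => by ring
    rw [← e1, ← e2, ← e3, ← e4, ← e5, hy₁]
    simp only [map_add, add_apply]
    rw [hB a y, hB b y, hB b a]
    ring
  have hM0 : ∑ i, ∑ j, M.M0 i j * B (F i) (F j) =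
      2 * ∑ i, ∑ j, M.α i * (M.A i j * B (F i) (F j)) -
        ∑ i, ∑ j, M.α i * M.α j * B (F i) (F j) := by
    have e : ∑ i, ∑ j, M.A j i * M.α j * B (F i) (F j) =
        ∑ i, ∑ j, M.α i * (M.A i j * B (F i) (F j)) := by
      rw [Finset.sum_comm]
      exact Finset.sum_congr rfl fun i _ => Finset.sum_congr rfl fun j _ => by
        rw [hB (F j)]; ring
    rw [two_mul]
    nth_rw 1 [← e]
    simp only [← Finset.sum_add_distrib, ← Finset.sum_sub_distrib]
    refine Finset.sum_congr rfl fun i _ => Finset.sum_congr rfl fun j _ => ?_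
    simp [M0, Matrix.vecMulVec_apply]
    ring
  have hM1 : ∑ i, ∑ j, M.M1 i j * B (G i) (G j) =
      2 * ∑ i, ∑ j, M.β i * (M.B i j * B (G i) (G j)) -
        ∑ i, ∑ j, M.β i * M.β j * B (G i) (G j) := by
    have e : ∑ i, ∑ j, M.B j i * M.β j * B (G i) (G j) =
        ∑ i, ∑ j, M.β i * (M.B i j * B (G i) (G j)) := by
      rw [Finset.sum_comm]
      exact Finset.sum_congr rfl fun i _ => Finset.sum_congr rfl fun j _ => by
        rw [hB (G j)]; ring
    rw [two_mul]
    nth_rw 1 [← e]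
    simp only [← Finset.sum_add_distrib, ← Finset.sum_sub_distrib]
    refine Finset.sum_congr rfl fun i _ => Finset.sum_congr rfl fun j _ => ?_
    simp [M1, Matrix.vecMulVec_apply]
    ring
  have hMs : ∑ i, ∑ j, M.Mstar i j * B (F i) (G j) =
      ∑ i, ∑ j, M.α i * (M.B i j * B (F i) (G j)) +
        ∑ i, ∑ j, M.β i * (M.A i j * B (F j) (G i)) -
        ∑ i, ∑ j, M.α i * M.β j * B (F i) (G j) := by
    rw [Finset.sum_comm (f := fun i j => M.β i * (M.A i j * B (F j) (G i)))]
    simp only [← Finset.sum_add_distrib, ← Finset.sum_sub_distrib]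
    refine Finset.sum_congr rfl fun i _ => Finset.sum_congr rfl fun j _ => ?_
    simp [Mstar, Matrix.vecMulVec_apply]
    ring
  have eF : ∑ i, M.α i * B y (F i) = -(∑ i, ∑ j, M.α i * (M.A i j * B (F i) (F j)) +
      ∑ i, ∑ j, M.α i * (M.B i j * B (F i) (G j))) := by
    simp only [hyF, mul_neg, mul_add, Finset.mul_sum, Finset.sum_add_distrib,
      Finset.sum_neg_distrib]
  have eG : ∑ i, M.β i * B y (G i) = -(∑ i, ∑ j, M.β i * (M.A i j * B (F j) (G i)) +
      ∑ i, ∑ j, M.β i * (M.B i j * B (G i) (G j))) := by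
    simp only [hyG, mul_neg, mul_add, Finset.mul_sum, Finset.sum_add_distrib,
      Finset.sum_neg_distrib]
  rw [hL, hM0, hM1, hMs, eF, eG]
  ring

theorem exists_local_error_bound {d : ℕ} {f g : EuclideanSpace ℝ (Fin d) → EuclideanSpace ℝ (Fin d)}
    (hf : ContDiff ℝ (⊤ : ℕ∞) f) (hg : ContDiff ℝ (⊤ : ℕ∞) g)
    {C : Matrix (Fin d) (Fin d) ℝ} (hC : C.IsSymm) (hinv : IsSDEInvariant f g (quadForm C)) {p : ℕ}
    (h0 : ∀ ι ι' : ColouredTree, ι.rootColour = 0 → ι'.rootColour = 0 →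
      ι.weight + ι'.weight < p → M.Φ ι ⬝ᵥ M.M0 *ᵥ M.Φ ι' = 0)
    (hstar : ∀ ι ι' : ColouredTree, ι.rootColour = 0 → ι'.rootColour = 1 →
      ι.weight + ι'.weight < p → M.Φ ι ⬝ᵥ M.Mstar *ᵥ M.Φ ι' = 0)
    (h1 : ∀ ι ι' : ColouredTree, ι.rootColour = 1 → ι'.rootColour = 1 →
      ι.weight + ι'.weight < p → M.Φ ι ⬝ᵥ M.M1 *ᵥ M.Φ ι' = 0) (R Θ : ℝ) :
    ∃ K, 0 ≤ K ∧ ∀ (h w θ : ℝ) (y y₁ : EuclideanSpace ℝ (Fin d))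
      (Y : Fin s → EuclideanSpace ℝ (Fin d)), 0 ≤ θ → θ ≤ Θ → |h| ≤ θ ^ 2 → |w| ≤ θ → ‖y‖ ≤ R →
      (∀ i, ‖Y i - y‖ ≤ R) →
      (∀ i, Y i = y + h • ∑ j, M.A i j • f (Y j) + w • ∑ j, M.B i j • g (Y j)) →
      y₁ = y + h • ∑ i, M.α i • f (Y i) + w • ∑ i, M.β i • g (Y i) →
      |quadForm C y₁ - quadForm C y| ≤ K * θ ^ p := by
  -- Tree expansions are uniform over an index type. Taking for it all admissible data of a single
  -- step makes the resulting constant independent of the step.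
  let 𝒟 := {x : ℝ × ℝ × ℝ × EuclideanSpace ℝ (Fin d) × (Fin s → EuclideanSpace ℝ (Fin d)) //
    0 ≤ x.2.2.1 ∧ x.2.2.1 ≤ Θ ∧ |x.1| ≤ x.2.2.1 ^ 2 ∧ |x.2.1| ≤ x.2.2.1 ∧ ‖x.2.2.2.1‖ ≤ R ∧
    (∀ i, ‖x.2.2.2.2 i - x.2.2.2.1‖ ≤ R) ∧
    ∀ i, x.2.2.2.2 i = x.2.2.2.1 + x.1 • ∑ j, M.A i j • f (x.2.2.2.2 j) +
      x.2.1 • ∑ j, M.B i j • g (x.2.2.2.2 j)}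
  let h : 𝒟 → ℝ := fun x => x.1.1
  let w : 𝒟 → ℝ := fun x => x.1.2.1
  let θ : 𝒟 → ℝ := fun x => x.1.2.2.1
  let y : 𝒟 → EuclideanSpace ℝ (Fin d) := fun x => x.1.2.2.2.1
  let Y : 𝒟 → Fin s → EuclideanSpace ℝ (Fin d) := fun x => x.1.2.2.2.2
  let U : 𝒟 → Fin s → EuclideanSpace ℝ (Fin d) := fun x i => Y x i - y x
  have hθ0 : ∀ x, 0 ≤ θ x := fun x => x.2.1
  have hθ : ∀ x, θ x ≤ Θ := fun x => x.2.2.1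
  have hh : ∀ x, |h x| ≤ θ x ^ 2 := fun x => x.2.2.2.1
  have hw : ∀ x, |w x| ≤ θ x := fun x => x.2.2.2.2.1
  have hy : ∀ x, ‖y x‖ ≤ R := fun x => x.2.2.2.2.2.1
  have hUR : ∀ x i, ‖U x i‖ ≤ R := fun x => x.2.2.2.2.2.2.1
  have hyU : ∀ x i, y x + U x i = Y x i := fun x i => add_sub_cancel _ _
  have hst : ∀ x i, U x i = h x • ∑ j, M.A i j • f (y x + U x j) +
      w x • ∑ j, M.B i j • g (y x + U x j) := by
    intro x i
    simp only [hyU]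
    have := x.2.2.2.2.2.2.2 i
    change Y x i = y x + h x • ∑ j, M.A i j • f (Y x j) + w x • ∑ j, M.B i j • g (Y x j) at this
    rw [← sub_eq_zero, ← sub_eq_zero.2 this]
    simp only [U]
    abel
  have hexp := HasTreeExpansion.of_stage M hθ0 hθ hy hUR hf hg hh hw hst p
  have hF := ((HasTreeExpansion.smul_comp M hθ0 hθ hy hexp hf (c := h) (k := 0)
      ⟨1, fun x => by simpa [ColouredTree.rootWeight] using hh x⟩).mono hθ0 hθ
      (q := p) (by simp))
  have hG := ((HasTreeExpansion.smul_comp M hθ0 hθ hy hexp hg (c := w) (k := 1)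
      ⟨1, fun x => by simpa [ColouredTree.rootWeight] using hw x⟩).mono hθ0 hθ
      (q := p) (by simp))
  simp only [hyU] at hF hG
  obtain ⟨K0, hK0, hK0'⟩ :=
    HasTreeExpansion.exists_bilinear_bound M hθ0 hθ (matrixBilin C) M.M0 hF hF h0
  obtain ⟨Ks, hKs, hKs'⟩ :=
    HasTreeExpansion.exists_bilinear_bound M hθ0 hθ (matrixBilin C) M.Mstar hF hG hstar
  obtain ⟨K1, hK1, hK1'⟩ :=
    HasTreeExpansion.exists_bilinear_bound M hθ0 hθ (matrixBilin C) M.M1 hG hG h1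
  refine ⟨K0 + 2 * Ks + K1, by positivity, ?_⟩
  intro h' w' θ' y' y₁ Y' ha hb hc hd he hi hj hstep
  let x : 𝒟 := ⟨(h', w', θ', y', Y'), ha, hb, hc, hd, he, hi, hj⟩
  have i0 := hK0' x
  have is := hKs' x
  have i1 := hK1' x
  have hBf : ∀ z, matrixBilin C z (f z) = 0 := fun z => by
    have := (hinv.2 z).1
    rw [fderiv_quadForm hC] at this
    linarith
  have hBg : ∀ z, matrixBilin C z (g z) = 0 := fun z => by
    have := (hinv.2 z).2
    rw [fderiv_quadForm hC] at this
    linarith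
  have key := M.bilinear_step_identity (matrixBilin C) (matrixBilin_symm hC) (y := y') (y₁ := y₁)
    (Y := Y') (F := fun i => h' • f (Y' i)) (G := fun i => w' • g (Y' i))
    (fun i => by
      rw [hj i]
      simp only [Finset.smul_sum, smul_comm h', smul_comm w'])
    (by
      rw [hstep]
      simp only [Finset.smul_sum, smul_comm h', smul_comm w'])
    (fun i => by rw [map_smul, hBf, smul_zero]) (fun i => by rw [map_smul, hBg, smul_zero])
  rw [quadForm_eq_matrixBilin, quadForm_eq_matrixBilin, key, abs_neg]
  change |∑ i, ∑ j, M.M0 i j * matrixBilin C (h' • f (Y' i)) (h' • f (Y' j))| ≤ K0 * θ' ^ p at i0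
  change |∑ i, ∑ j, M.Mstar i j * matrixBilin C (h' • f (Y' i)) (w' • g (Y' j))| ≤
    Ks * θ' ^ p at is
  change |∑ i, ∑ j, M.M1 i j * matrixBilin C (w' • g (Y' i)) (w' • g (Y' j))| ≤ K1 * θ' ^ p at i1
  refine (abs_add_le _ _).trans ?_
  refine (add_le_add_left (abs_add_le _ _) _).trans ?_
  rw [abs_mul, abs_two]
  linarith

end SRKMethod

/-! ### The flow of a globally Lipschitz vector field -/

section Flow

variable {E : Type*} [NormedAddCommGroup E] [NormedSpace ℝ E]

/-- `φ t x` is the value at time `t` of the solution of `u' = g(u)` with `u(0) = x`. -/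
structure IsGlobalFlow (g : E → E) (φ : ℝ → E → E) : Prop where
  zero : ∀ x, φ 0 x = x
  hasDerivAt : ∀ x t, HasDerivAt (fun t => φ t x) (g (φ t x)) t

-- A global Lipschitz bound gives a local existence time `1 / (L + 1)` that does not depend on the
-- initial point; integral curves existing for a uniform time extend to all times.
open scoped Manifold in
theorem exists_isGlobalFlow [CompleteSpace E] {g : E → E} (hg : ContDiff ℝ (⊤ : ℕ∞) g) {L : ℝ≥0}
    (hL : LipschitzWith L g) : ∃ φ, IsGlobalFlow g φ := by
  have hloc : ∀ x : E, ∃ γ : ℝ → E, γ 0 = x ∧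
      IsMIntegralCurveOn (I := 𝓘(ℝ, E)) γ (fun x => (g x : TangentSpace 𝓘(ℝ, E) x))
        (Set.Ioo (-(1 / ((L : ℝ) + 1))) (1 / ((L : ℝ) + 1))) := by
    intro x
    set ε : ℝ := 1 / ((L : ℝ) + 1) with hε
    have hε0 : 0 < ε := by positivity
    -- On the ball of radius `a` the speed is at most `‖g x‖ + L * a ≤ (L + 1) * a`, so a curve
    -- cannot leave it before time `1 / (L + 1)`.
    let a : ℝ≥0 := ‖g x‖₊ + 1
    have hpl : IsPicardLindelof (fun _ : ℝ => g) (tmin := -ε) (tmax := ε)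
        ⟨0, by constructor <;> linarith⟩ x a 0 (‖g x‖₊ + L * a) L := by
      refine ⟨fun _ _ => hL.lipschitzOnWith, fun _ _ => continuousOn_const, fun _ _ z hz => ?_, ?_⟩
      · have h1 : ‖g z - g x‖ ≤ L * ‖z - x‖ := hL.norm_sub_le z x
        have h2 : ‖z - x‖ ≤ a := by simpa [dist_eq_norm] using hz
        have h3 : ‖g z‖ ≤ ‖g x‖ + ‖g z - g x‖ := by
          simpa using norm_add_le (g x) (g z - g x)
        push_cast
        have h4 := mul_le_mul_of_nonneg_left h2 L.coe_nonneg
        linarith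
      · simp only [sub_zero, zero_sub, neg_neg, max_self, NNReal.coe_zero]
        rw [hε, mul_one_div, div_le_iff₀ (by positivity)]
        simp only [a]
        push_cast
        nlinarith [norm_nonneg (g x), L.coe_nonneg]
    obtain ⟨γ, h0, h1⟩ := hpl.exists_eq_forall_mem_Icc_hasDerivWithinAt₀
    refine ⟨γ, h0, fun t ht => ?_⟩
    exact ((h1 t (Set.Ioo_subset_Icc_self ht)).mono
      Set.Ioo_subset_Icc_self).hasFDerivWithinAt.hasMFDerivWithinAt
  have hsm : ContMDiff 𝓘(ℝ, E) (𝓘(ℝ, E).tangent) 1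
      (fun x => (⟨x, g x⟩ : TangentBundle 𝓘(ℝ, E) E)) :=
    contMDiff_vectorSpace_iff_contDiff.2 (hg.of_le (by exact_mod_cast le_top))
  have hex := exists_isMIntegralCurve_of_isMIntegralCurveOn hsm
    (by positivity : 0 < 1 / ((L : ℝ) + 1)) hloc
  choose γ h0 h1 using hex
  refine ⟨fun t x => γ x t, h0, fun x t => ?_⟩
  have h2 : HasFDerivAt (γ x) ((1 : ℝ →L[ℝ] ℝ).smulRight (g (γ x t))) t := (h1 x t).hasFDerivAt
  have h3 := h2.hasDerivAt
  simp only [ContinuousLinearMap.smulRight_apply, one_apply_eq_self, one_smul] at h3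
  exact h3

namespace IsGlobalFlow

variable {g : E → E} {φ : ℝ → E → E} {L : ℝ≥0}

theorem neg (h : IsGlobalFlow g φ) : IsGlobalFlow (fun x => -g x) (fun t => φ (-t)) where
  zero x := by simpa using h.zero x
  hasDerivAt x t := by
    simpa [Function.comp_def] using (h.hasDerivAt x (-t)).scomp t (hasDerivAt_neg t)

theorem continuous (h : IsGlobalFlow g φ) (x : E) : Continuous fun t => φ t x :=
  continuous_iff_continuousAt.2 fun t => (h.hasDerivAt x t).continuousAt

theorem add (h : IsGlobalFlow g φ) (hL : LipschitzWith L g) (t s : ℝ) (x : E) :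
    φ (t + s) x = φ t (φ s x) := by
  have := ODE_solution_unique_univ (v := fun _ => g) (s := fun _ => Set.univ) (K := L) (t₀ := 0)
    (f := fun t => φ (t + s) x) (g := fun t => φ t (φ s x)) (fun _ => hL.lipschitzOnWith)
    (fun t => ⟨(h.hasDerivAt x (t + s)).comp_add_const t s, trivial⟩)
    (fun t => ⟨h.hasDerivAt _ t, trivial⟩) (by simp [h.zero])
  exact congrFun this t

theorem norm_sub_le (h : IsGlobalFlow g φ) (hL : LipschitzWith L g) (t : ℝ) (x y : E) :
    ‖φ t x - φ t y‖ ≤ Real.exp (L * |t|) * ‖x - y‖ := by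
  have key : ∀ {g : E → E} {φ : ℝ → E → E}, IsGlobalFlow g φ → LipschitzWith L g → ∀ t, 0 ≤ t →
      ‖φ t x - φ t y‖ ≤ Real.exp (L * t) * ‖x - y‖ := by
    intro g φ h hL t ht
    have := dist_le_of_trajectories_ODE (v := fun _ => g) (K := L) (a := 0) (b := t)
      (δ := ‖x - y‖) (fun _ => hL) (h.continuous x).continuousOn
      (fun s _ => (h.hasDerivAt x s).hasDerivWithinAt) (h.continuous y).continuousOn
      (fun s _ => (h.hasDerivAt y s).hasDerivWithinAt) (by simp [h.zero, dist_eq_norm]) t ⟨ht, le_rfl⟩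
    rw [dist_eq_norm, sub_zero, mul_comm] at this
    exact this
  rcases le_total 0 t with ht | ht
  · rw [abs_of_nonneg ht]; exact key h hL t ht
  · have := key h.neg hL.neg (-t) (by linarith)
    rw [abs_of_nonpos ht]
    simpa using this

/-- Second-order accuracy of an Euler step along the flow. Only the Lipschitz constant enters, so no
bound on second derivatives is required and the error is linear in `‖g x‖`, hence compatible with
Gronwall. -/
theorem norm_sub_sub_smul_le (h : IsGlobalFlow g φ) (hL : LipschitzWith L g) (t : ℝ) (x : E) :
    ‖φ t x - x - t • g x‖ ≤ (L + 1) * Real.exp ((L + 1) * |t|) * t ^ 2 * ‖g x‖ := by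
  have key : ∀ {g : E → E} {φ : ℝ → E → E}, IsGlobalFlow g φ → LipschitzWith L g → ∀ t, 0 ≤ t →
      ‖φ t x - x - t • g x‖ ≤ (L + 1) * Real.exp ((L + 1) * t) * t ^ 2 * ‖g x‖ := by
    intro g φ h hL t ht
    have hL1 : (0 : ℝ) < L + 1 := by positivity
    have h1 : ∀ s ∈ Set.Icc 0 t, ‖φ s x - x‖ ≤ t * Real.exp ((L + 1) * t) * ‖g x‖ := by
      intro s hs
      have := norm_le_gronwallBound_of_norm_deriv_right_le (f := fun s => φ s x - x)
        (f' := fun s => g (φ s x)) (δ := 0) (K := L + 1) (ε := ‖g x‖) (a := 0) (b := t)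
        ((h.continuous x).sub continuous_const).continuousOn
        (fun s _ => ((h.hasDerivAt x s).sub_const x).hasDerivWithinAt) (by simp [h.zero])
        (fun s _ => by
          have h1 := hL.norm_sub_le (φ s x) x
          have h3 : ‖g (φ s x)‖ ≤ ‖g x‖ + ‖g (φ s x) - g x‖ := by
            simpa using norm_add_le (g x) (g (φ s x) - g x)
          have := norm_nonneg (φ s x - x)
          nlinarith) s hs
      refine this.trans ?_
      rw [gronwallBound_of_K_ne_0 hL1.ne']
      simp only [sub_zero, zero_mul, zero_add]
      have e1 : Real.exp ((L + 1) * s) - 1 ≤ (L + 1) * t * Real.exp ((L + 1) * t) := by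
        have a1 : Real.exp ((L + 1) * s) ≤ Real.exp ((L + 1) * t) := by
          gcongr; exact hs.2
        have a2 := Real.add_one_le_exp (-((L + 1) * t))
        have a3 : Real.exp ((L + 1) * t) * Real.exp (-((L + 1) * t)) = 1 := by
          rw [← Real.exp_add]; simp
        nlinarith [Real.exp_pos ((L + 1) * t)]
      rw [div_mul_eq_mul_div, div_le_iff₀ hL1]
      nlinarith [norm_nonneg (g x)]
    have h2 := norm_image_sub_le_of_norm_deriv_le_segment' (a := 0) (b := t)
      (f := fun s => φ s x - x - s • g x) (f' := fun s => g (φ s x) - g x)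
      (C := (L + 1) * (t * Real.exp ((L + 1) * t) * ‖g x‖))
      (fun s _ => by
        have := ((h.hasDerivAt x s).sub_const x).sub ((hasDerivAt_id s).smul_const (g x))
        rw [one_smul] at this
        exact this.hasDerivWithinAt)
      (fun s hs => by
        refine (hL.norm_sub_le _ _).trans ?_
        have := h1 s ⟨hs.1, hs.2.le⟩
        gcongr
        linarith) t ⟨ht, le_rfl⟩
    simp only [h.zero, sub_self, zero_smul, sub_zero] at h2
    refine h2.trans (le_of_eq ?_)
    ring
  rcases le_total 0 t with ht | ht
  · rw [abs_of_nonneg ht]; exact key h hL t ht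
  · have := key h.neg hL.neg (-t) (by linarith)
    rw [abs_of_nonpos ht]
    simpa using this

end IsGlobalFlow

end Flow

/-! ### Boundedness of the numerical solution -/

namespace SRKMethod

variable {s : ℕ} (M : SRKMethod s) {E : Type*} [NormedAddCommGroup E] [NormedSpace ℝ E]
  {f g : E → E} {K : ℝ}

/-- For an explicit method the stages are bounded successively, with no restriction on the step.
Otherwise `h + |w| ≤ η` lets the stage deviations on the right be absorbed on the left. -/
theorem exists_stage_bound (hK : 0 ≤ K) (hf : ∀ y, ‖f y‖ ≤ K * (1 + ‖y‖))
    (hg : ∀ y, ‖g y‖ ≤ K * (1 + ‖y‖)) {H : ℝ} (hH : 0 ≤ H) :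
    ∃ K₁ η, 0 ≤ K₁ ∧ 0 < η ∧ ∀ (h w : ℝ) (y : E) (Y : Fin s → E), 0 ≤ h → h + |w| ≤ H →
      (M.IsExplicit ∨ h + |w| ≤ η) →
      (∀ i, Y i = y + h • ∑ j, M.A i j • f (Y j) + w • ∑ j, M.B i j • g (Y j)) →
      ∀ i, ‖Y i - y‖ ≤ K₁ * (h + |w|) * (1 + ‖y‖) := by
  set a : ℝ := ∑ i, ∑ j, (|M.A i j| + |M.B i j|) with ha
  have ha0 : 0 ≤ a := by positivity
  set q : ℝ := 1 + H * K * a with hq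
  have hq1 : 1 ≤ q := by rw [hq]; have : 0 ≤ H * K * a := by positivity
                         linarith
  -- `q` is the growth factor per explicit stage, and `η` is chosen so that `(h + |w|) * K * a ≤ 1 /
  -- 2`. The sum `2 + q ^ s` serves both cases.
  refine ⟨K * a * (2 + q ^ s), 1 / (2 * (K * a + 1)), by positivity, by positivity, ?_⟩
  intro h w y Y hh hH' hor hY
  set κ := h + |w| with hκ
  have hκ0 : 0 ≤ κ := by positivity
  have hrow : ∀ i, ∑ j, (|M.A i j| + |M.B i j|) ≤ a := fun i =>
    Finset.single_le_sum (f := fun i => ∑ j, (|M.A i j| + |M.B i j|))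
      (fun _ _ => by positivity) (Finset.mem_univ i)
  have hbase : ∀ i, ‖Y i - y‖ ≤ κ * K * ∑ j, (|M.A i j| + |M.B i j|) * (1 + ‖Y j‖) := by
    intro i
    have key : ∀ (c : Fin s → ℝ) (F : E → E), (∀ y, ‖F y‖ ≤ K * (1 + ‖y‖)) →
        ‖∑ j, c j • F (Y j)‖ ≤ K * ∑ j, |c j| * (1 + ‖Y j‖) := by
      intro c F hF
      rw [Finset.mul_sum]
      refine (norm_sum_le _ _).trans (Finset.sum_le_sum fun j _ => ?_)
      rw [norm_smul, Real.norm_eq_abs, mul_left_comm]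
      exact mul_le_mul_of_nonneg_left (hF _) (abs_nonneg _)
    have e : Y i - y = h • ∑ j, M.A i j • f (Y j) + w • ∑ j, M.B i j • g (Y j) := by
      rw [sub_eq_iff_eq_add]
      conv_lhs => rw [hY i]
      abel
    rw [e]
    refine (norm_add_le _ _).trans ?_
    rw [norm_smul, norm_smul, Real.norm_of_nonneg hh, Real.norm_eq_abs]
    have k1 := key (M.A i) f hf
    have k2 := key (M.B i) g hg
    have hw : |w| ≤ κ := by rw [hκ]; linarith
    have hh' : h ≤ κ := by rw [hκ]; linarith [abs_nonneg w]
    calc _ ≤ κ * (K * ∑ j, |M.A i j| * (1 + ‖Y j‖)) + κ * (K * ∑ j, |M.B i j| * (1 + ‖Y j‖)) := by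
          gcongr
      _ = _ := by simp only [add_mul _ _ (1 + ‖Y _‖), Finset.sum_add_distrib]; ring
  rcases hor with hexp | hη
  · have hind : ∀ i : Fin s, 1 + ‖Y i‖ ≤ q ^ ((i : ℕ) + 1) * (1 + ‖y‖) := by
      intro i
      induction i using WellFoundedLT.induction with
      | ind i ih =>
      have h1 : ∑ j, (|M.A i j| + |M.B i j|) * (1 + ‖Y j‖) ≤
          a * (q ^ (i : ℕ) * (1 + ‖y‖)) := by
        refine le_trans ?_ (mul_le_mul_of_nonneg_right (hrow i) (by positivity))
        rw [Finset.sum_mul]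
        refine Finset.sum_le_sum fun j _ => ?_
        by_cases hj : j < i
        · refine mul_le_mul_of_nonneg_left ((ih j hj).trans ?_) (by positivity)
          gcongr
          exact hj
        · simp [hexp i j (not_lt.1 hj)]
      have h2 : ‖Y i‖ ≤ ‖y‖ + ‖Y i - y‖ := by simpa using norm_add_le y (Y i - y)
      have h3 := hbase i
      have h4 : κ * K * ∑ j, (|M.A i j| + |M.B i j|) * (1 + ‖Y j‖) ≤
          H * K * (a * (q ^ (i : ℕ) * (1 + ‖y‖))) := by gcongr
      have h5 : 1 + ‖y‖ ≤ q ^ (i : ℕ) * (1 + ‖y‖) :=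
        le_mul_of_one_le_left (by positivity) (one_le_pow₀ hq1)
      have h6 : q ^ ((i : ℕ) + 1) * (1 + ‖y‖) =
          q ^ (i : ℕ) * (1 + ‖y‖) + H * K * (a * (q ^ (i : ℕ) * (1 + ‖y‖))) := by
        rw [pow_succ, hq]; ring
      linarith
    intro i
    have h1 : ∑ j, (|M.A i j| + |M.B i j|) * (1 + ‖Y j‖) ≤ a * (q ^ s * (1 + ‖y‖)) := by
      refine le_trans ?_ (mul_le_mul_of_nonneg_right (hrow i) (by positivity))
      rw [Finset.sum_mul]
      refine Finset.sum_le_sum fun j _ => ?_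
      refine mul_le_mul_of_nonneg_left ((hind j).trans ?_) (by positivity)
      gcongr
      exact j.2
    calc ‖Y i - y‖ ≤ κ * K * (a * (q ^ s * (1 + ‖y‖))) := (hbase i).trans (by gcongr)
      _ = K * a * q ^ s * κ * (1 + ‖y‖) := by ring
      _ ≤ _ := by
        gcongr
        linarith
  · set m := ‖fun i => Y i - y‖ with hm
    have hm0 : 0 ≤ m := norm_nonneg _
    have hYm : ∀ i, ‖Y i - y‖ ≤ m := fun i => norm_le_pi_norm (fun i => Y i - y) i
    have h1 : m ≤ κ * K * (a * (1 + ‖y‖ + m)) := by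
      rw [hm, pi_norm_le_iff_of_nonneg (by positivity)]
      intro i
      refine (hbase i).trans ?_
      gcongr
      refine le_trans ?_ (mul_le_mul_of_nonneg_right (hrow i) (by positivity))
      rw [Finset.sum_mul]
      refine Finset.sum_le_sum fun j _ => ?_
      have h2 : ‖Y j‖ ≤ ‖y‖ + ‖Y j - y‖ := by simpa using norm_add_le y (Y j - y)
      refine mul_le_mul_of_nonneg_left ?_ (by positivity)
      linarith [hYm j]
    have h2 : κ * (K * a) ≤ 1 / 2 := by
      rw [le_div_iff₀ (by positivity)] at hη
      nlinarith
    have h3 : κ * K * (a * (1 + ‖y‖ + m)) = κ * (K * a) * (1 + ‖y‖) + κ * (K * a) * m := by ring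
    have h4 : m ≤ 2 * (κ * (K * a)) * (1 + ‖y‖) := by nlinarith
    intro i
    refine (hYm i).trans (h4.trans ?_)
    calc 2 * (κ * (K * a)) * (1 + ‖y‖) = K * a * 2 * κ * (1 + ‖y‖) := by ring
      _ ≤ _ := by
        gcongr
        have : 0 ≤ q ^ s := by positivity
        linarith

/-- Replacing each `g (Y i)` by `g y` costs `|w| * (h + |w|) = O(h + w ^ 2)`. What remains is an
Euler step for `(∑ β_i) g` driven by `w`. -/
theorem exists_step_bound (hK : 0 ≤ K) (hf : ∀ y, ‖f y‖ ≤ K * (1 + ‖y‖)) {L : ℝ≥0}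
    (hL : LipschitzWith L g) {H : ℝ} (hH : 0 ≤ H) {K₁ : ℝ} (hK₁ : 0 ≤ K₁) :
    ∃ K₂, 0 ≤ K₂ ∧ ∀ (h w : ℝ) (y : E) (Y : Fin s → E), 0 ≤ h → h + |w| ≤ H →
      (∀ i, ‖Y i - y‖ ≤ K₁ * (h + |w|) * (1 + ‖y‖)) →
      ‖(y + h • ∑ i, M.α i • f (Y i) + w • ∑ i, M.β i • g (Y i)) - y -
        (w * ∑ i, M.β i) • g y‖ ≤ K₂ * (h + w ^ 2) * (1 + ‖y‖) := by
  refine ⟨(∑ i, |M.α i|) * (K * (1 + K₁ * H)) + (∑ i, |M.β i|) * (L * K₁ * (H + 1)),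
    by positivity, ?_⟩
  intro h w y Y hh hH' hY
  have e : (y + h • ∑ i, M.α i • f (Y i) + w • ∑ i, M.β i • g (Y i)) - y -
        (w * ∑ i, M.β i) • g y =
      h • ∑ i, M.α i • f (Y i) + w • ∑ i, M.β i • (g (Y i) - g y) := by
    simp only [smul_sub, Finset.sum_sub_distrib, mul_smul, Finset.sum_smul]
    abel
  have h1 : ‖∑ i, M.α i • f (Y i)‖ ≤ (∑ i, |M.α i|) * (K * (1 + K₁ * H) * (1 + ‖y‖)) := by
    rw [Finset.sum_mul]
    refine (norm_sum_le _ _).trans (Finset.sum_le_sum fun i _ => ?_)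
    rw [norm_smul, Real.norm_eq_abs]
    refine mul_le_mul_of_nonneg_left ((hf _).trans ?_) (abs_nonneg _)
    rw [mul_assoc]
    refine mul_le_mul_of_nonneg_left ?_ hK
    have h2 : ‖Y i‖ ≤ ‖y‖ + ‖Y i - y‖ := by simpa using norm_add_le y (Y i - y)
    have h3 : K₁ * (h + |w|) * (1 + ‖y‖) ≤ K₁ * H * (1 + ‖y‖) := by gcongr
    linarith [hY i]
  have h2 : ‖∑ i, M.β i • (g (Y i) - g y)‖ ≤
      (∑ i, |M.β i|) * (L * K₁ * (h + |w|) * (1 + ‖y‖)) := by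
    rw [Finset.sum_mul]
    refine (norm_sum_le _ _).trans (Finset.sum_le_sum fun i _ => ?_)
    rw [norm_smul, Real.norm_eq_abs]
    refine mul_le_mul_of_nonneg_left ((hL.norm_sub_le _ _).trans ?_) (abs_nonneg _)
    rw [mul_assoc, mul_assoc, ← mul_assoc K₁]
    exact mul_le_mul_of_nonneg_left (hY i) L.coe_nonneg
  have h3 : |w| * (h + |w|) ≤ (H + 1) * (h + w ^ 2) := by
    have := abs_nonneg w
    have h4 : |w| ≤ H := by linarith
    rw [← sq_abs w]
    nlinarith
  rw [e]
  refine (norm_add_le _ _).trans ?_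
  rw [norm_smul, norm_smul, Real.norm_of_nonneg hh, Real.norm_eq_abs]
  calc _ ≤ (h + w ^ 2) * ((∑ i, |M.α i|) * (K * (1 + K₁ * H) * (1 + ‖y‖))) +
        |w| * ((∑ i, |M.β i|) * (L * K₁ * (h + |w|) * (1 + ‖y‖))) := by
        gcongr
        have := sq_nonneg w
        linarith
    _ = (h + w ^ 2) * ((∑ i, |M.α i|) * (K * (1 + K₁ * H) * (1 + ‖y‖))) +
        (|w| * (h + |w|)) * ((∑ i, |M.β i|) * (L * K₁ * (1 + ‖y‖))) := by ring
    _ ≤ (h + w ^ 2) * ((∑ i, |M.α i|) * (K * (1 + K₁ * H) * (1 + ‖y‖))) +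
        ((H + 1) * (h + w ^ 2)) * ((∑ i, |M.β i|) * (L * K₁ * (1 + ‖y‖))) := by gcongr
    _ = _ := by ring

end SRKMethod

theorem le_mul_exp_sum {u c : ℕ → ℝ} {N : ℕ} (hu0 : ∀ n, 0 ≤ u n)
    (hu : ∀ n < N, u (n + 1) ≤ (1 + c n) * u n) :
    ∀ n ≤ N, u n ≤ u 0 * Real.exp (∑ k ∈ Finset.range n, c k) := by
  intro n hn
  induction n with
  | zero => simp
  | succ n ih =>
    rw [Finset.sum_range_succ, Real.exp_add, ← mul_assoc]
    calc u (n + 1) ≤ (1 + c n) * u n := hu n hn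
      _ ≤ Real.exp (c n) * u n := by
        have := Real.add_one_le_exp (c n)
        have := hu0 n
        gcongr
        linarith
      _ = u n * Real.exp (c n) := mul_comm _ _
      _ ≤ _ := by gcongr; exact ih (by omega)

/-- A recursion which is, up to `O(h + ΔW²)`, the Euler scheme for `dy = b g(y) dW` stays bounded;
the bound depends on the increments only through their partial sums and their sum of squares. -/
theorem IsGlobalFlow.exists_bound {E : Type*} [NormedAddCommGroup E] [NormedSpace ℝ E] {g : E → E}
    {φ : ℝ → E → E} (hφ : IsGlobalFlow g φ) {L : ℝ≥0} (hL : LipschitzWith L g) {K : ℝ} (hK : 0 ≤ K)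
    (hg : ∀ y, ‖g y‖ ≤ K * (1 + ‖y‖)) (b : ℝ) {K₂ : ℝ} (hK₂ : 0 ≤ K₂) {R : ℝ} (hR : 0 ≤ R) :
    ∃ R', 0 ≤ R' ∧ ∀ (h : ℝ) (N : ℕ) (y : ℕ → E) (S : ℕ → ℝ), 0 ≤ h → N * h ≤ 1 → ‖y 0‖ ≤ R →
      S 0 = 0 → (∀ n ≤ N, |S n| ≤ R) → ∑ n ∈ Finset.range N, (S (n + 1) - S n) ^ 2 ≤ R →
      (∀ n < N, ‖y (n + 1) - y n - ((S (n + 1) - S n) * b) • g (y n)‖ ≤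
        K₂ * (h + (S (n + 1) - S n) ^ 2) * (1 + ‖y n‖)) → ∀ n ≤ N, ‖y n‖ ≤ R' := by
  set T := |b| * R with hT
  have hT0 : 0 ≤ T := by positivity
  obtain ⟨c₀, hc₀⟩ := (isCompact_Icc (a := -T) (b := T)).exists_bound_of_continuousOn
    (hφ.continuous 0).continuousOn
  -- `c` bounds the linear growth of the flow maps `φ t` uniformly for `|t| ≤ T`.
  set c := Real.exp (L * T) + |c₀| + 1 with hc
  have hc0 : 0 ≤ c := by positivity
  have hgrow : ∀ t x, |t| ≤ T → 1 + ‖φ t x‖ ≤ c * (1 + ‖x‖) := by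
    intro t x ht
    have h1 := hφ.norm_sub_le hL t x 0
    rw [sub_zero] at h1
    have h2 : ‖φ t x‖ ≤ ‖φ t x - φ t 0‖ + ‖φ t 0‖ := by
      simpa using norm_add_le (φ t x - φ t 0) (φ t 0)
    have h3 := (hc₀ t (abs_le.1 ht)).trans (le_abs_self _)
    have h4 : Real.exp (L * |t|) * ‖x‖ ≤ Real.exp (L * T) * ‖x‖ := by gcongr
    have h5 := Real.exp_pos (L * T)
    rw [hc]
    nlinarith [norm_nonneg x, abs_nonneg c₀]
  set K₃ := Real.exp (L * T) *
    ((K₂ + (L + 1) * Real.exp ((L + 1) * (2 * T)) * b ^ 2 * K) * c) with hK₃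
  have hK₃0 : 0 ≤ K₃ := by positivity
  refine ⟨c * ((1 + R) * Real.exp (K₃ * (1 + R))), by positivity, ?_⟩
  intro h N y S hh hN hy0 hS0 hS hQ hrec
  have hbS : ∀ n ≤ N, |b * S n| ≤ T := fun n hn => by
    rw [abs_mul, hT]
    exact mul_le_mul_of_nonneg_left (hS n hn) (abs_nonneg _)
  -- Undoing the flow removes the first-order term in the increment: `z (n + 1)` and `z n` are
  -- images under the same map `φ (-(b * S (n + 1)))` of `y (n + 1)` and `φ (δ * b) (y n)`, which
  -- differ by `O(h + δ ^ 2)`.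
  set z : ℕ → E := fun n => φ (-(b * S n)) (y n) with hz
  have hyz : ∀ n, y n = φ (b * S n) (z n) := fun n => by
    simp only [hz]
    rw [← hφ.add hL, add_neg_cancel, hφ.zero]
  have hyz' : ∀ n ≤ N, 1 + ‖y n‖ ≤ c * (1 + ‖z n‖) := fun n hn => by
    have := hgrow (b * S n) (z n) (hbS n hn)
    rwa [← hyz] at this
  have hstep : ∀ n < N, 1 + ‖z (n + 1)‖ ≤
      (1 + K₃ * (h + (S (n + 1) - S n) ^ 2)) * (1 + ‖z n‖) := by
    intro n hn
    set δ := S (n + 1) - S n with hδ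
    have e1 : z n = φ (-(b * S (n + 1))) (φ (δ * b) (y n)) := by
      simp only [hz]
      rw [← hφ.add hL]
      congr 1
      rw [hδ]; ring
    have h1 : ‖z (n + 1) - z n‖ ≤ Real.exp (L * T) * ‖y (n + 1) - φ (δ * b) (y n)‖ := by
      rw [e1]
      refine (hφ.norm_sub_le hL _ _ _).trans ?_
      gcongr
      rw [abs_neg]
      exact hbS _ hn
    have hδT : |δ * b| ≤ 2 * T := by
      have a1 := hbS _ hn
      have a2 := hbS n hn.le
      rw [show δ * b = b * S (n + 1) - b * S n by rw [hδ]; ring]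
      exact (abs_sub _ _).trans (by linarith)
    have h2 : ‖y (n + 1) - φ (δ * b) (y n)‖ ≤
        (K₂ + (L + 1) * Real.exp ((L + 1) * (2 * T)) * b ^ 2 * K) * (h + δ ^ 2) * (1 + ‖y n‖) := by
      have a1 := hrec n hn
      have a2 := hφ.norm_sub_sub_smul_le hL (δ * b) (y n)
      have a3 := _root_.norm_sub_le (y (n + 1) - y n - (δ * b) • g (y n))
        (φ (δ * b) (y n) - y n - (δ * b) • g (y n))
      rw [sub_sub_sub_cancel_right, sub_sub_sub_cancel_right] at a3
      have a4 : (L + 1) * Real.exp ((L + 1) * |δ * b|) * (δ * b) ^ 2 * ‖g (y n)‖ ≤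
          (L + 1) * Real.exp ((L + 1) * (2 * T)) * (b ^ 2 * (h + δ ^ 2)) * (K * (1 + ‖y n‖)) := by
        gcongr
        · rw [mul_pow, mul_comm]
          gcongr
          linarith
        · exact hg _
      calc _ ≤ _ := a3
        _ ≤ K₂ * (h + δ ^ 2) * (1 + ‖y n‖) + _ := add_le_add a1 (a2.trans a4)
        _ = _ := by ring
    have h3 := hyz' n hn.le
    have h4 : ‖z (n + 1)‖ ≤ ‖z n‖ + ‖z (n + 1) - z n‖ := by
      simpa using norm_add_le (z n) (z (n + 1) - z n)
    have h5 : ‖z (n + 1) - z n‖ ≤ K₃ * (h + δ ^ 2) * (1 + ‖z n‖) := by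
      calc _ ≤ _ := h1
        _ ≤ Real.exp (L * T) * ((K₂ + (L + 1) * Real.exp ((L + 1) * (2 * T)) * b ^ 2 * K) *
            (h + δ ^ 2) * (c * (1 + ‖z n‖))) := by
          refine mul_le_mul_of_nonneg_left (h2.trans ?_) (Real.exp_pos _).le
          gcongr
        _ = _ := by rw [hK₃]; ring
    linarith
  intro n hn
  have hg := le_mul_exp_sum (u := fun n => 1 + ‖z n‖)
    (c := fun n => K₃ * (h + (S (n + 1) - S n) ^ 2)) (fun n => by positivity) hstep n hn
  have hz0 : z 0 = y 0 := by simp [hz, hS0, hφ.zero]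
  have hsum : ∑ k ∈ Finset.range n, K₃ * (h + (S (k + 1) - S k) ^ 2) ≤ K₃ * (1 + R) := by
    rw [← Finset.mul_sum, Finset.sum_add_distrib, Finset.sum_const, Finset.card_range, nsmul_eq_mul]
    have a1 : (n : ℝ) * h ≤ N * h := by gcongr
    have a2 : ∑ k ∈ Finset.range n, (S (k + 1) - S k) ^ 2 ≤
        ∑ k ∈ Finset.range N, (S (k + 1) - S k) ^ 2 :=
      Finset.sum_le_sum_of_subset_of_nonneg (by simpa using hn) fun _ _ _ => sq_nonneg _
    gcongr
    · linarith
    · linarith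
  have h6 : 1 + ‖z n‖ ≤ (1 + R) * Real.exp (K₃ * (1 + R)) := by
    refine hg.trans ?_
    simp only [hz0]
    gcongr
  have h7 := hyz' n hn
  have h8 : c * (1 + ‖z n‖) ≤ c * ((1 + R) * Real.exp (K₃ * (1 + R))) := by gcongr
  linarith

/-! ### Path properties of Brownian motion -/

section Probability

open scoped ENNReal

variable {Ω : Type*} [MeasurableSpace Ω] {P : Measure Ω}

/-- The exponent `x² / (4v)` is half of the one in the Gaussian density, so for `v ≠ 0` the integral
equals `√2`. For `v = 0` the quotient is `0` by convention. -/
theorem lintegral_exp_sq_div_gaussianReal_le (v : ℝ≥0) :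
    ∫⁻ x, ENNReal.ofReal (Real.exp (x ^ 2 / (4 * v))) ∂(gaussianReal 0 v) ≤ 2 := by
  rcases eq_or_ne v 0 with rfl | hv
  · rw [gaussianReal_zero_var, lintegral_dirac]
    norm_num
  have hv' : (0 : ℝ) < v := by positivity
  have hm : Measurable fun x : ℝ => ENNReal.ofReal (Real.exp (x ^ 2 / (4 * v))) := by fun_prop
  rw [gaussianReal_of_var_ne_zero _ hv,
    lintegral_withDensity_eq_lintegral_mul _ (measurable_gaussianPDF 0 v) hm]
  have e : ∀ x : ℝ, (gaussianPDF 0 v * fun x : ℝ => ENNReal.ofReal (Real.exp (x ^ 2 / (4 * v)))) x =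
      ENNReal.ofReal ((√(2 * Real.pi * v))⁻¹ * Real.exp (-(1 / (4 * v)) * x ^ 2)) := by
    intro x
    rw [Pi.mul_apply, gaussianPDF, ← ENNReal.ofReal_mul (gaussianPDFReal_nonneg _ _ _),
      gaussianPDFReal, mul_assoc, ← Real.exp_add]
    congr 3
    field_simp
    ring
  simp only [e]
  rw [← ofReal_integral_eq_lintegral_ofReal ((integrable_exp_neg_mul_sq (by positivity)).const_mul _)
    (Filter.Eventually.of_forall fun x => by positivity), integral_const_mul, integral_gaussian,
    ← Real.sqrt_inv, ← Real.sqrt_mul (by positivity)]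
  have : (2 * Real.pi * v)⁻¹ * (Real.pi / (1 / (4 * v))) = 2 := by
    have := Real.pi_pos
    field_simp
    norm_num
  rw [this]
  have h2 : √2 ≤ (2 : ℝ) := by
    rw [Real.sqrt_le_left (by norm_num)]; norm_num
  calc ENNReal.ofReal √2 ≤ ENNReal.ofReal 2 := ENNReal.ofReal_le_ofReal h2
    _ = 2 := by norm_num

theorem ProbabilityTheory.IsPreBrownianReal.lintegral_exp_sq_sub_le {W : ℝ≥0 → Ω → ℝ}
    (hW : IsPreBrownianReal W P) (s t : ℝ≥0) :
    ∫⁻ ω, ENNReal.ofReal (Real.exp ((W s ω - W t ω) ^ 2 / (4 * nndist (s : ℝ) t))) ∂P ≤ 2 := by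
  have h := (hW.hasLaw_sub s t).lintegral_comp
    (f := fun x => ENNReal.ofReal (Real.exp (x ^ 2 / (4 * nndist (s : ℝ) t)))) (by fun_prop)
  exact h.trans_le (lintegral_exp_sq_div_gaussianReal_le _)

theorem ProbabilityTheory.IsPreBrownianReal.lintegral_exp_sum_sq_le {W : ℝ≥0 → Ω → ℝ}
    (hW : IsPreBrownianReal W P) (h : ℝ≥0) (N : ℕ) :
    ∫⁻ ω, ENNReal.ofReal (Real.exp (∑ n ∈ Finset.range N,
      (pathIncrement (fun t => W t ω) h n) ^ 2 / (4 * h))) ∂P ≤ 2 ^ N := by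
  have hind := hW.hasIndepIncrements.nat (t := fun n : ℕ => (n : ℝ≥0) * h)
    (fun m n hmn => by dsimp only; gcongr)
  have hmeas : ∀ n : ℕ, AEMeasurable (fun ω => W (((n + 1 : ℕ) : ℝ≥0) * h) ω - W (n * h) ω) P :=
    fun n => (hW.aemeasurable _).sub (hW.aemeasurable _)
  -- The increments are only almost everywhere measurable; measurable versions are used to factor
  -- the integral by independence.
  have hind' := (hind.congr fun n => (hmeas n).ae_eq_mk).comp
    (fun _ x => ENNReal.ofReal (Real.exp (x ^ 2 / (4 * h)))) (fun _ => by fun_prop)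
  have hprod := lintegral_prod_eq_prod_lintegral_of_indepFun (Finset.range N) _ hind'
    (fun n => by have := (hmeas n).measurable_mk; simp only [Function.comp_def]; fun_prop)
  have hae : ∀ᵐ ω ∂P, ∀ n : ℕ, (hmeas n).mk _ ω = W (((n + 1 : ℕ) : ℝ≥0) * h) ω - W (n * h) ω :=
    ae_all_iff.2 fun n => (hmeas n).ae_eq_mk.symm
  have e1 : ∫⁻ ω, ENNReal.ofReal (Real.exp (∑ n ∈ Finset.range N,
      (pathIncrement (fun t => W t ω) h n) ^ 2 / (4 * h))) ∂P =
      ∏ n ∈ Finset.range N, ∫⁻ ω, ENNReal.ofReal (Real.exp (((hmeas n).mk _ ω) ^ 2 / (4 * h))) ∂P := by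
    refine Eq.trans (lintegral_congr_ae ?_) hprod
    filter_upwards [hae] with ω hω
    rw [Real.exp_sum, ENNReal.ofReal_prod_of_nonneg fun _ _ => (Real.exp_pos _).le]
    refine Finset.prod_congr rfl fun n _ => ?_
    simp only [Function.comp_def, hω n, pathIncrement]
    push_cast
    rfl
  rw [e1]
  refine (Finset.prod_le_pow_card _ _ 2 fun n _ => ?_).trans (by simp)
  have h2 := hW.lintegral_exp_sq_sub_le (((n + 1 : ℕ) : ℝ≥0) * h) (n * h)
  refine le_trans (le_of_eq (lintegral_congr_ae ?_)) h2
  filter_upwards [hae] with ω hω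
  rw [hω n]
  have hd : (nndist (((((n + 1 : ℕ) : ℝ≥0) * h : ℝ≥0) : ℝ)) (((n : ℝ≥0) * h : ℝ≥0) : ℝ) : ℝ) = h := by
    rw [coe_nndist, Real.dist_eq]
    push_cast
    rw [show ((n : ℝ) + 1) * h - n * h = h by ring]
    exact abs_of_nonneg h.coe_nonneg
  rw [hd]

/-- Countably many random variables with exponential moments `exp (m i)` are simultaneously bounded
by `Ξ + m i + c i` if `∑ exp (- c i)` converges. -/
theorem exists_ae_forall_le_of_lintegral_exp_le {ι : Type*} [Countable ι] {F : ι → Ω → ℝ}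
    (hF : ∀ i, AEMeasurable (F i) P) {m c : ι → ℝ}
    (hm : ∀ i, ∫⁻ ω, ENNReal.ofReal (Real.exp (F i ω)) ∂P ≤ ENNReal.ofReal (Real.exp (m i)))
    (hc : Summable fun i => Real.exp (-c i)) :
    ∃ Ξ : Ω → ℝ, Measurable Ξ ∧ (∀ ω, 0 ≤ Ξ ω) ∧ ∀ᵐ ω ∂P, ∀ i, F i ω ≤ Ξ ω + m i + c i := by
  -- The series `∑ G i` has finite expectation, hence is almost surely finite, and its sum serves as
  -- `Ξ`: each term is at most the sum, and `x + 1 ≤ exp x` recovers the bound on `F i`.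
  set G : ι → Ω → ℝ≥0∞ := fun i ω => ENNReal.ofReal (Real.exp (F i ω - m i - c i)) with hG
  have hGm : ∀ i, AEMeasurable (G i) P := fun i => by
    have := hF i
    simp only [hG]
    fun_prop
  have hint : ∀ i, ∫⁻ ω, G i ω ∂P ≤ ENNReal.ofReal (Real.exp (-c i)) := by
    intro i
    have e : ∀ ω, G i ω = ENNReal.ofReal (Real.exp (-m i - c i)) *
        ENNReal.ofReal (Real.exp (F i ω)) := fun ω => by
      rw [← ENNReal.ofReal_mul (Real.exp_pos _).le, ← Real.exp_add]
      simp only [hG]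
      congr 2
      ring
    simp only [e]
    rw [lintegral_const_mul' _ _ ENNReal.ofReal_ne_top]
    calc _ ≤ ENNReal.ofReal (Real.exp (-m i - c i)) * ENNReal.ofReal (Real.exp (m i)) := by
          gcongr; exact hm i
      _ = _ := by
          rw [← ENNReal.ofReal_mul (Real.exp_pos _).le, ← Real.exp_add]
          congr 2
          ring
  have hZm : AEMeasurable (fun ω => ∑' i, G i ω) P := AEMeasurable.tsum hGm
  have hZ : ∫⁻ ω, ∑' i, G i ω ∂P ≠ ∞ := by
    rw [lintegral_tsum hGm]
    refine ne_top_of_le_ne_top ?_ (ENNReal.tsum_le_tsum hint)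
    exact hc.tsum_ofReal_ne_top
  refine ⟨fun ω => (hZm.mk _ ω).toReal, hZm.measurable_mk.ennreal_toReal,
    fun ω => ENNReal.toReal_nonneg, ?_⟩
  filter_upwards [ae_lt_top' hZm hZ, hZm.ae_eq_mk] with ω h1 h2 i
  have h3 : G i ω ≤ ∑' i, G i ω := ENNReal.le_tsum i
  have h4 := ENNReal.toReal_mono h1.ne h3
  rw [h2] at h4
  simp only [hG] at h4
  rw [ENNReal.toReal_ofReal (Real.exp_pos _).le] at h4
  have h5 := Real.add_one_le_exp (F i ω - m i - c i)
  linarith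

theorem summable_exp_neg_two_log_add : Summable fun i : ℕ × ℕ =>
    Real.exp (-(2 * Real.log (i.1 + 1) + 2 * Real.log (i.2 + 1))) := by
  have h : Summable fun n : ℕ => (((n : ℝ) + 1) ^ 2)⁻¹ := by
    have := (summable_nat_add_iff 1).2 (Real.summable_nat_pow_inv.2 (le_refl 2))
    simpa using this
  have h2 := h.mul_of_nonneg h (fun _ => by positivity) (fun _ => by positivity)
  refine h2.congr fun i => ?_
  have e : ∀ n : ℕ, Real.exp (-(2 * Real.log ((n : ℝ) + 1))) = (((n : ℝ) + 1) ^ 2)⁻¹ := fun n => by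
    rw [Real.exp_neg, two_mul, Real.exp_add, Real.exp_log (by positivity), sq]
  rw [neg_add, Real.exp_add, e, e]

end Probability

/-! ### Hölder continuity and sums of squared increments of Brownian paths -/

/-- A continuous path whose dyadic increments at level `n` are at most `A 2 ^ (-a n)` is Hölder
continuous of exponent `a` on `[0, 1]`. -/
theorem exists_holder_of_dyadic {a : ℝ} (ha : 0 < a) :
    ∃ c : ℝ, 0 ≤ c ∧ ∀ (w : ℝ≥0 → ℝ) (A : ℝ), Continuous w → 0 ≤ A →
      (∀ n k : ℕ, k < 2 ^ n → |w ((k + 1) / 2 ^ n) - w (k / 2 ^ n)| ≤ A * ((2 : ℝ) ^ (-a)) ^ n) →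
      ∀ s t : ℝ≥0, s ≤ 1 → t ≤ 1 → |w s - w t| ≤ c * A * |(s : ℝ) - t| ^ a := by
  set r : ℝ := (2 : ℝ) ^ (-a) with hr
  have hr0 : 0 < r := by positivity
  have hr1 : r < 1 := Real.rpow_lt_one_of_one_lt_of_neg one_lt_two (by linarith)
  have h1r : 0 < 1 - r := by linarith
  refine ⟨(1 + 2 / (1 - r)) * (2 : ℝ) ^ a, by positivity, ?_⟩
  intro w A hw hA hinc
  -- Dyadic rounding down. Consecutive levels differ by at most one cell of the finer level, so `w
  -- (D n t)` converges geometrically to `w t`.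
  let D : ℕ → ℝ≥0 → ℝ≥0 := fun n t => (⌊t * 2 ^ n⌋₊ : ℝ≥0) / 2 ^ n
  have hfloor : ∀ n (t : ℝ≥0), (⌊t * 2 ^ n⌋₊ : ℝ≥0) ≤ t * 2 ^ n := fun n t =>
    Nat.floor_le zero_le
  have hDlim : ∀ t, Filter.Tendsto (fun n => D n t) Filter.atTop (nhds t) := by
    intro t
    have h2 : Filter.Tendsto (fun n : ℕ => (2 : ℝ≥0) ^ n) Filter.atTop Filter.atTop :=
      tendsto_pow_atTop_atTop_of_one_lt one_lt_two
    have h := (tendsto_nat_floor_mul_div_atTop (R := ℝ) (a := (t : ℝ)) t.coe_nonneg).comp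
      (tendsto_pow_atTop_atTop_of_one_lt (r := (2 : ℝ)) one_lt_two)
    rw [← NNReal.tendsto_coe]
    refine h.congr fun n => ?_
    simp only [D, Function.comp_def]
    push_cast
    congr 2
  have hnext : ∀ t ≤ 1, ∀ n, dist (w (D n t)) (w (D (n + 1) t)) ≤ A * r * r ^ n := by
    intro t ht n
    have h1 := hfloor (n + 1) t
    have h2 : (⌊t * 2 ^ (n + 1)⌋₊ : ℝ≥0) ≤ 2 ^ (n + 1) := h1.trans (mul_le_of_le_one_left' ht)
    have h3 : D n t = ((2 * ⌊t * 2 ^ n⌋₊ : ℕ) : ℝ≥0) / 2 ^ (n + 1) := by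
      simp only [D]
      push_cast
      rw [pow_succ, mul_comm (2 ^ n) 2, mul_div_mul_left _ _ two_ne_zero]
    have h4 : 2 * ⌊t * 2 ^ n⌋₊ ≤ ⌊t * 2 ^ (n + 1)⌋₊ := by
      refine Nat.le_floor ?_
      push_cast
      rw [pow_succ, ← mul_assoc, mul_comm]
      gcongr
      exact hfloor n t
    have h5 : ⌊t * 2 ^ (n + 1)⌋₊ < 2 * ⌊t * 2 ^ n⌋₊ + 2 := by
      rw [Nat.floor_lt zero_le]
      have := Nat.lt_floor_add_one (t * 2 ^ n)
      push_cast
      calc t * 2 ^ (n + 1) = (t * 2 ^ n) * 2 := by rw [pow_succ, mul_assoc]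
        _ < (⌊t * 2 ^ n⌋₊ + 1) * 2 := by gcongr
        _ = _ := by ring
    have hD : D (n + 1) t = (⌊t * 2 ^ (n + 1)⌋₊ : ℝ≥0) / 2 ^ (n + 1) := rfl
    rw [mul_assoc, ← pow_succ', h3, hD]
    rcases (by omega : ⌊t * 2 ^ (n + 1)⌋₊ = 2 * ⌊t * 2 ^ n⌋₊ ∨
      ⌊t * 2 ^ (n + 1)⌋₊ = 2 * ⌊t * 2 ^ n⌋₊ + 1) with h6 | h6
    · rw [h6, dist_self]; positivity
    · rw [h6, dist_comm, Real.dist_eq]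
      have h7 : 2 * ⌊t * 2 ^ n⌋₊ < 2 ^ (n + 1) := by
        have : ⌊t * 2 ^ (n + 1)⌋₊ ≤ 2 ^ (n + 1) := by exact_mod_cast h2
        omega
      have h8 := hinc (n + 1) _ h7
      push_cast at h8 ⊢
      exact h8
  have hlim : ∀ t ≤ 1, ∀ n, |w (D n t) - w t| ≤ A * r ^ n / (1 - r) := by
    intro t ht n
    have h1 := dist_le_of_le_geometric_of_tendsto r (A * r) hr1 (hnext t ht)
      ((hw.tendsto t).comp (hDlim t)) n
    rw [Real.dist_eq] at h1
    refine h1.trans ?_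
    gcongr
    exact mul_le_of_le_one_right hA hr1.le
  have hle : ∀ s t : ℝ≥0, s < t → t ≤ 1 →
      |w s - w t| ≤ (1 + 2 / (1 - r)) * (2 : ℝ) ^ a * A * |(s : ℝ) - t| ^ a := by
    intro s t hst ht
    have hst' : (s : ℝ) < t := by exact_mod_cast hst
    have ht' : (t : ℝ) ≤ 1 := by exact_mod_cast ht
    -- At the scale `2 ^ (-n-1) < t - s ≤ 2 ^ (-n)` the roundings of `s` and `t` are equal or
    -- adjacent. The chain through them gives the factor `1 + 2 / (1 - r)`, and the gap between the
    -- two scales gives `2 ^ a`.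
    obtain ⟨n, hn1, hn2⟩ := exists_nat_pow_near_of_lt_one (x := (t : ℝ) - s) (y := 1 / 2)
      (by linarith) (by linarith [s.coe_nonneg]) (by norm_num) (by norm_num)
    have hsn := hlim s (hst.le.trans ht) n
    have htn := hlim t ht n
    have hmid : |w (D n s) - w (D n t)| ≤ A * r ^ n := by
      have h4 : ⌊s * 2 ^ n⌋₊ ≤ ⌊t * 2 ^ n⌋₊ := Nat.floor_le_floor (by gcongr)
      have h5 : ⌊t * 2 ^ n⌋₊ < ⌊s * 2 ^ n⌋₊ + 2 := by
        rw [Nat.floor_lt zero_le]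
        have h6 := Nat.lt_floor_add_one (s * 2 ^ n)
        have h7 : (t : ℝ) * 2 ^ n ≤ s * 2 ^ n + 1 := by
          have : ((t : ℝ) - s) * 2 ^ n ≤ (1 / 2) ^ n * 2 ^ n := by gcongr
          rw [← mul_pow] at this
          norm_num at this
          linarith
        have h8 : t * 2 ^ n ≤ s * 2 ^ n + 1 := by exact_mod_cast h7
        refine h8.trans_lt ?_
        push_cast
        calc s * 2 ^ n + 1 < (⌊s * 2 ^ n⌋₊ + 1) + 1 := by gcongr
          _ = _ := by ring
      simp only [D]
      rcases (by omega : ⌊t * 2 ^ n⌋₊ = ⌊s * 2 ^ n⌋₊ ∨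
        ⌊t * 2 ^ n⌋₊ = ⌊s * 2 ^ n⌋₊ + 1) with h6 | h6
      · rw [h6, sub_self, abs_zero]; positivity
      · have h7 : ⌊s * 2 ^ n⌋₊ < 2 ^ n := by
          have h1 : (⌊t * 2 ^ n⌋₊ : ℝ≥0) ≤ 2 ^ n := (hfloor n t).trans (mul_le_of_le_one_left' ht)
          have : ⌊t * 2 ^ n⌋₊ ≤ 2 ^ n := by exact_mod_cast h1
          omega
        have h8 := hinc n _ h7
        rw [h6, abs_sub_comm]
        push_cast
        exact h8
    have hsum : |w s - w t| ≤ (1 + 2 / (1 - r)) * (A * r ^ n) := by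
      have e : w s - w t = -(w (D n s) - w s) + (w (D n s) - w (D n t)) + (w (D n t) - w t) := by
        ring
      rw [e]
      refine (abs_add_three _ _ _).trans ?_
      rw [abs_neg]
      have : (1 + 2 / (1 - r)) * (A * r ^ n) =
        A * r ^ n / (1 - r) + A * r ^ n + A * r ^ n / (1 - r) := by ring
      linarith
    have hrn : r ^ n ≤ 2 ^ a * |(s : ℝ) - t| ^ a := by
      rw [abs_sub_comm, abs_of_pos (by linarith), ← Real.mul_rpow (by norm_num) (by linarith), hr,
        ← Real.rpow_natCast, ← Real.rpow_mul (by norm_num), mul_comm, Real.rpow_mul (by norm_num),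
        Real.rpow_natCast, Real.rpow_neg (by positivity), ← Real.inv_rpow (by positivity)]
      refine Real.rpow_le_rpow (by positivity) ?_ ha.le
      rw [pow_succ] at hn1
      rw [← inv_pow, ← one_div]
      linarith
    calc _ ≤ _ := hsum
      _ ≤ (1 + 2 / (1 - r)) * (A * (2 ^ a * |(s : ℝ) - t| ^ a)) := by gcongr
      _ = _ := by ring
  intro s t hs ht
  rcases lt_trichotomy s t with h | rfl | h
  · exact hle s t h ht
  · rw [sub_self, abs_zero]; positivity
  · rw [abs_sub_comm, abs_sub_comm (s : ℝ)]
    exact hle t s h hs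

/-- Hölder continuity of exponent `a` on `[0, 1]` together with a bound on the sums of squared
increments along all uniform partitions. -/
structure IsRegularPath (a R : ℝ) (w : ℝ≥0 → ℝ) : Prop where
  holder : ∀ s t : ℝ≥0, s ≤ 1 → t ≤ 1 → |w s - w t| ≤ R * |(s : ℝ) - t| ^ a
  sum_sq_le : ∀ (h : ℝ≥0) (N : ℕ), (N : ℝ) * h ≤ 1 →
    ∑ n ∈ Finset.range N, (pathIncrement w h n) ^ 2 ≤ R

theorem IsRegularPath.mono {a R R' : ℝ} {w : ℝ≥0 → ℝ} (h : IsRegularPath a R w) (hR : R ≤ R') :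
    IsRegularPath a R' w where
  holder s t hs ht := (h.holder s t hs ht).trans (by gcongr)
  sum_sq_le k N hN := (h.sum_sq_le k N hN).trans hR

/-- The nodes `n * h` and `n * h'` with `n ≤ k` differ by at most `(k + 1) ^ (-2)`, so for `a ≥ 1/4`
the path values differ by at most `R * (k + 1) ^ (-1/2)`. Squared and summed over `k` increments,
this is `O(R ^ 2)`. -/
theorem sum_sq_pathIncrement_le_of_close {a R : ℝ} (ha : 1 / 4 ≤ a) (hR : 0 ≤ R) {w : ℝ≥0 → ℝ}
    (hw : ∀ s t : ℝ≥0, s ≤ 1 → t ≤ 1 → |w s - w t| ≤ R * |(s : ℝ) - t| ^ a) {h h' : ℝ≥0} {k : ℕ}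
    (hk1 : (k : ℝ) * h ≤ 1) (hle : (h' : ℝ) ≤ h) (hge : (h : ℝ) - h' ≤ 1 / ((k : ℝ) + 1) ^ 3) :
    ∑ n ∈ Finset.range k, (pathIncrement w h n) ^ 2 ≤
      2 * ∑ n ∈ Finset.range k, (pathIncrement w h' n) ^ 2 + 8 * R ^ 2 := by
  have hk0 : (0 : ℝ) ≤ k := k.cast_nonneg
  have hkh' : (k : ℝ) * h' ≤ 1 := (mul_le_mul_of_nonneg_left hle hk0).trans hk1
  have herr : ∀ n ≤ k, |w (n * h) - w (n * h')| ≤ R * (((k : ℝ) + 1)⁻¹) ^ (1 / 2 : ℝ) := by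
    intro n hn
    have hn' : (n : ℝ) ≤ k := by exact_mod_cast hn
    have t1 : (n : ℝ≥0) * h ≤ 1 := by
      have : (n : ℝ) * h ≤ 1 := (mul_le_mul_of_nonneg_right hn' h.coe_nonneg).trans hk1
      exact_mod_cast this
    have t2 : (n : ℝ≥0) * h' ≤ 1 := by
      have : (n : ℝ) * h' ≤ 1 := (mul_le_mul_of_nonneg_right hn' h'.coe_nonneg).trans hkh'
      exact_mod_cast this
    refine (hw _ _ t1 t2).trans (mul_le_mul_of_nonneg_left ?_ hR)
    push_cast
    rw [← mul_sub, abs_of_nonneg (mul_nonneg n.cast_nonneg (by linarith))]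
    have b1 : (n : ℝ) * (h - h') ≤ (((k : ℝ) + 1)⁻¹) ^ 2 := by
      calc (n : ℝ) * (h - h') ≤ (k + 1) * (1 / ((k : ℝ) + 1) ^ 3) := by
            gcongr
            linarith
        _ = _ := by field_simp
    have b2 : (((k : ℝ) + 1)⁻¹) ≤ 1 := inv_le_one_of_one_le₀ (by linarith)
    calc ((n : ℝ) * (h - h')) ^ a ≤ ((((k : ℝ) + 1)⁻¹) ^ 2) ^ a := by
          refine Real.rpow_le_rpow (mul_nonneg n.cast_nonneg (by linarith)) b1 (by linarith)
      _ ≤ ((((k : ℝ) + 1)⁻¹) ^ 2) ^ (1 / 4 : ℝ) := by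
          refine Real.rpow_le_rpow_of_exponent_ge (by positivity) ?_ ha
          exact pow_le_one₀ (by positivity) b2
      _ = _ := by
          rw [← Real.rpow_natCast, ← Real.rpow_mul (by positivity)]
          norm_num
  have hterm : ∀ n ∈ Finset.range k, (pathIncrement w h n) ^ 2 ≤
      2 * (pathIncrement w h' n) ^ 2 + 8 * R ^ 2 * ((k : ℝ) + 1)⁻¹ := by
    intro n hn
    have hn := Finset.mem_range.1 hn
    have e1 := herr n hn.le
    have e2 := herr (n + 1) hn
    push_cast at e2
    set x := (((k : ℝ) + 1)⁻¹) ^ (1 / 2 : ℝ) with hx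
    have hx2 : x ^ 2 = ((k : ℝ) + 1)⁻¹ := by
      rw [hx, ← Real.rpow_natCast, ← Real.rpow_mul (by positivity)]
      norm_num
    have e3 : |pathIncrement w h n - pathIncrement w h' n| ≤ 2 * (R * x) := by
      have : pathIncrement w h n - pathIncrement w h' n =
        (w ((n + 1) * h) - w ((n + 1) * h')) - (w (n * h) - w (n * h')) := by
        simp only [pathIncrement]; ring
      rw [this]
      exact (abs_sub _ _).trans (by linarith)
    have e4 := pow_le_pow_left₀ (abs_nonneg _) e3 2
    rw [sq_abs] at e4
    have e5 : (2 * (R * x)) ^ 2 = 4 * R ^ 2 * ((k : ℝ) + 1)⁻¹ := by rw [← hx2]; ring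
    rw [e5] at e4
    nlinarith [sq_nonneg (pathIncrement w h n - 2 * pathIncrement w h' n)]
  calc ∑ n ∈ Finset.range k, (pathIncrement w h n) ^ 2
      ≤ ∑ n ∈ Finset.range k, (2 * (pathIncrement w h' n) ^ 2 + 8 * R ^ 2 * ((k : ℝ) + 1)⁻¹) :=
        Finset.sum_le_sum hterm
    _ = 2 * ∑ n ∈ Finset.range k, (pathIncrement w h' n) ^ 2 +
        8 * R ^ 2 * (k * ((k : ℝ) + 1)⁻¹) := by
        rw [Finset.sum_add_distrib, ← Finset.mul_sum, Finset.sum_const, Finset.card_range,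
          nsmul_eq_mul]
        ring
    _ ≤ 2 * ∑ n ∈ Finset.range k, (pathIncrement w h' n) ^ 2 + 8 * R ^ 2 * 1 := by
        gcongr
        rw [← div_eq_mul_inv, div_le_one (by positivity)]
        linarith
    _ = _ := by ring

/-- With `k = ⌊1 / h⌋`, round `h` down to a multiple `h'` of `(k + 1) ^ (-3)`. The grid bound
multiplied by `4 * h'` stays bounded since `k * h' ≤ 1`: the logarithms are only `O(k)`. -/
theorem sum_sq_pathIncrement_le {a R Ξ : ℝ} (ha : 1 / 4 ≤ a) (hR : 0 ≤ R) (hΞ : 0 ≤ Ξ)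
    {w : ℝ≥0 → ℝ} (hw : ∀ s t : ℝ≥0, s ≤ 1 → t ≤ 1 → |w s - w t| ≤ R * |(s : ℝ) - t| ^ a)
    (hgrid : ∀ k j : ℕ, ∑ n ∈ Finset.range k,
      (pathIncrement w ((j : ℝ≥0) / ((k : ℝ≥0) + 1) ^ 3) n) ^ 2 /
        (4 * (((j : ℝ≥0) / ((k : ℝ≥0) + 1) ^ 3 : ℝ≥0) : ℝ)) ≤
      Ξ + k * Real.log 2 + (2 * Real.log (k + 1) + 2 * Real.log (j + 1)))
    (h : ℝ≥0) (N : ℕ) (hN : (N : ℝ) * h ≤ 1) :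
    ∑ n ∈ Finset.range N, (pathIncrement w h n) ^ 2 ≤ 8 * Ξ + 120 + 8 * R ^ 2 := by
  rcases eq_or_ne h 0 with rfl | hh0
  · simp only [pathIncrement, mul_zero, sub_self]
    norm_num
    positivity
  have hh : (0 : ℝ) < h := by positivity
  rcases lt_or_ge (1 : ℝ) h with h1 | h1
  · have hN0 : N = 0 := by
      by_contra hne
      have : (1 : ℝ) ≤ N := by exact_mod_cast Nat.one_le_iff_ne_zero.2 hne
      nlinarith
    rw [hN0, Finset.sum_range_zero]
    positivity
  set k := ⌊1 / (h : ℝ)⌋₊ with hk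
  have hk1 : (k : ℝ) * h ≤ 1 := by
    rw [← le_div_iff₀ hh]
    exact Nat.floor_le (by positivity)
  have hk2 : 1 < ((k : ℝ) + 1) * h := by
    rw [← div_lt_iff₀ hh]
    exact Nat.lt_floor_add_one _
  have hNk : N ≤ k := Nat.le_floor (by rwa [le_div_iff₀ hh])
  have hk3 : (1 : ℝ) ≤ k := by
    have : 1 ≤ k := Nat.le_floor (by rw [le_div_iff₀ hh]; simpa using h1)
    exact_mod_cast this
  set j := ⌊(h : ℝ) * ((k : ℝ) + 1) ^ 3⌋₊ with hj
  set D : ℝ := ((k : ℝ) + 1) ^ 3 with hD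
  have hD0 : 0 < D := by positivity
  set h' : ℝ≥0 := (j : ℝ≥0) / ((k : ℝ≥0) + 1) ^ 3 with hh'
  have hh'e : (h' : ℝ) = j / D := by rw [hh', hD]; push_cast; rfl
  have hj1 : (j : ℝ) ≤ h * D := Nat.floor_le (by positivity)
  have hj2 : (h : ℝ) * D < j + 1 := Nat.lt_floor_add_one _
  have hle : (h' : ℝ) ≤ h := by rw [hh'e, div_le_iff₀ hD0]; exact hj1
  have hge : (h : ℝ) - h' ≤ 1 / D := by
    rw [hh'e, le_div_iff₀ hD0, sub_mul, div_mul_cancel₀ _ hD0.ne']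
    linarith
  have hh'pos : (0 : ℝ) < h' := by
    rw [hh'e]
    refine div_pos ?_ hD0
    have : 1 ≤ j := Nat.le_floor (by
      have : ((k : ℝ) + 1) ≤ ((k : ℝ) + 1) ^ 3 := le_self_pow₀ (by linarith) (by norm_num)
      push_cast
      nlinarith)
    exact_mod_cast this
  have hkh' : (k : ℝ) * h' ≤ 1 := by nlinarith
  have hgridk : ∑ n ∈ Finset.range k, (pathIncrement w h' n) ^ 2 ≤ 4 * Ξ + 60 := by
    have g1 := hgrid k j
    rw [← Finset.sum_div, div_le_iff₀ (by positivity)] at g1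
    have l1 : Real.log 2 ≤ 1 := by
      have := Real.log_le_sub_one_of_pos (x := 2) (by norm_num); linarith
    have l2 : Real.log ((k : ℝ) + 1) ≤ k := by
      have := Real.log_le_sub_one_of_pos (x := (k : ℝ) + 1) (by linarith); linarith
    have l3 : Real.log ((j : ℝ) + 1) ≤ 3 * (k + 1) := by
      have a1 : (j : ℝ) + 1 ≤ ((k : ℝ) + 2) ^ 3 := by
        have : (j : ℝ) ≤ D := hj1.trans (mul_le_of_le_one_left hD0.le h1)
        rw [hD] at this
        nlinarith
      have a2 := Real.log_le_log (by positivity) a1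
      rw [Real.log_pow] at a2
      have a3 := Real.log_le_sub_one_of_pos (x := (k : ℝ) + 2) (by linarith)
      push_cast at a2
      linarith
    have l4 : Ξ + k * Real.log 2 + (2 * Real.log (k + 1) + 2 * Real.log (j + 1)) ≤ Ξ + 15 * k := by
      nlinarith
    have l5 := mul_le_mul_of_nonneg_right l4 (by positivity : (0 : ℝ) ≤ 4 * h')
    have l6 : (Ξ + 15 * k) * (4 * (h' : ℝ)) ≤ 4 * Ξ + 60 := by nlinarith
    linarith
  calc ∑ n ∈ Finset.range N, (pathIncrement w h n) ^ 2
      ≤ ∑ n ∈ Finset.range k, (pathIncrement w h n) ^ 2 :=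
        Finset.sum_le_sum_of_subset_of_nonneg (by simpa using hNk) fun _ _ _ => sq_nonneg _
    _ ≤ 2 * ∑ n ∈ Finset.range k, (pathIncrement w h' n) ^ 2 + 8 * R ^ 2 :=
        sum_sq_pathIncrement_le_of_close ha hR hw hk1 hle hge
    _ ≤ _ := by linarith

/-- Both properties come from Gaussian exponential moments over a countable family: `Ξ₁` controls
all dyadic increments, `Ξ₂` the sums of squares for all step sizes `j / (k + 1) ^ 3`. -/
theorem ProbabilityTheory.IsBrownianReal.exists_isRegularPath {Ω : Type*} [MeasurableSpace Ω]
    {P : Measure Ω} {W : ℝ≥0 → Ω → ℝ} (hW : IsBrownianReal W P) {a : ℝ} (ha : 1 / 4 ≤ a)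
    (ha' : a < 1 / 2) :
    ∃ R : Ω → ℝ, Measurable R ∧ ∀ᵐ ω ∂P, IsRegularPath a (R ω) (fun t => W t ω) := by
  have hpre := hW.toIsPreBrownianReal
  obtain ⟨c, hc0, hc⟩ := exists_holder_of_dyadic (a := a) (by linarith)
  obtain ⟨Ξ₁, hΞ₁m, hΞ₁0, hΞ₁⟩ := exists_ae_forall_le_of_lintegral_exp_le (P := P) (ι := ℕ × ℕ)
    (F := fun i ω => (W (((i.2 : ℝ≥0) + 1) / 2 ^ i.1) ω - W ((i.2 : ℝ≥0) / 2 ^ i.1) ω) ^ 2 /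
      (4 * (1 / 2 ^ i.1))) (m := fun _ => Real.log 2)
    (fun i => by
      have h1 := hpre.aemeasurable (((i.2 : ℝ≥0) + 1) / 2 ^ i.1)
      have h2 := hpre.aemeasurable ((i.2 : ℝ≥0) / 2 ^ i.1)
      fun_prop)
    (fun i => by
      have h := hpre.lintegral_exp_sq_sub_le (((i.2 : ℝ≥0) + 1) / 2 ^ i.1) ((i.2 : ℝ≥0) / 2 ^ i.1)
      rw [Real.exp_log (by norm_num), ENNReal.ofReal_ofNat]
      convert h using 7
      rw [coe_nndist, Real.dist_eq]
      push_cast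
      rw [← sub_div, add_sub_cancel_left, abs_of_pos (by positivity)])
    summable_exp_neg_two_log_add
  obtain ⟨Ξ₂, hΞ₂m, hΞ₂0, hΞ₂⟩ := exists_ae_forall_le_of_lintegral_exp_le (P := P) (ι := ℕ × ℕ)
    (F := fun i ω => ∑ n ∈ Finset.range i.1,
      (pathIncrement (fun t => W t ω) ((i.2 : ℝ≥0) / ((i.1 : ℝ≥0) + 1) ^ 3) n) ^ 2 /
        (4 * (((i.2 : ℝ≥0) / ((i.1 : ℝ≥0) + 1) ^ 3 : ℝ≥0) : ℝ)))
    (m := fun i => i.1 * Real.log 2)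
    (fun i => by
      refine Finset.aemeasurable_fun_sum _ fun n _ => ?_
      simp only [pathIncrement]
      have h1 := hpre.aemeasurable (((n : ℝ≥0) + 1) * ((i.2 : ℝ≥0) / ((i.1 : ℝ≥0) + 1) ^ 3))
      have h2 := hpre.aemeasurable ((n : ℝ≥0) * ((i.2 : ℝ≥0) / ((i.1 : ℝ≥0) + 1) ^ 3))
      fun_prop)
    (fun i => by
      refine (hpre.lintegral_exp_sum_sq_le _ _).trans (le_of_eq ?_)
      rw [Real.exp_nat_mul, Real.exp_log (by norm_num), ENNReal.ofReal_pow (by norm_num),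
        ENNReal.ofReal_ofNat])
    summable_exp_neg_two_log_add
  set b := 1 - 2 * a with hb
  have hb0 : 0 < b := by linarith
  have hlog2 : 0 < Real.log 2 := Real.log_pos one_lt_two
  -- The squared dyadic increments at level `n` are at most `4 * 2 ^ (-n) * (Ξ₁ + 1 + 4 * n)`. The
  -- factor `n` is absorbed by `2 ^ (b * n) / (b * log 2)`, which leaves exactly `2 ^ (-2 * a * n)`.
  -- As `A ≥ 1`, it may be replaced by `A ^ 2` before taking square roots.
  set A : Ω → ℝ := fun ω => 4 * (Ξ₁ ω + 1 + 4 / (b * Real.log 2)) with hA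
  have hA1 : ∀ ω, 1 ≤ A ω := fun ω => by
    have := hΞ₁0 ω
    have : 0 < 4 / (b * Real.log 2) := by positivity
    simp only [hA]
    linarith
  refine ⟨fun ω => max (c * A ω) (8 * Ξ₂ ω + 120 + 8 * (c * A ω) ^ 2), by fun_prop, ?_⟩
  filter_upwards [hW.cont, hΞ₁, hΞ₂] with ω hcont h1 h2
  have hA0 : 0 ≤ A ω := zero_le_one.trans (hA1 ω)
  have hh := hc (fun t => W t ω) (A ω) hcont hA0 (fun n k hk => by
    have g := h1 (n, k)
    simp only at g
    have p2 : (0 : ℝ) < 2 ^ n := by positivity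
    have hk' : (k : ℝ) + 1 ≤ 2 ^ n := by exact_mod_cast hk
    have l1 : Real.log ((k : ℝ) + 1) ≤ n * Real.log 2 := by
      rw [← Real.log_pow]
      exact Real.log_le_log (by positivity) hk'
    have l2 : Real.log ((n : ℝ) + 1) ≤ n := by
      have := Real.log_le_sub_one_of_pos (x := (n : ℝ) + 1) (by positivity); linarith
    have l3 : Real.log 2 ≤ 1 := by
      have := Real.log_le_sub_one_of_pos (x := 2) (by norm_num); linarith
    rw [div_le_iff₀ (by positivity)] at g
    have l4 : Ξ₁ ω + Real.log 2 + (2 * Real.log (n + 1) + 2 * Real.log (k + 1)) ≤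
        Ξ₁ ω + 1 + 4 * n := by
      have : (n : ℝ) * Real.log 2 ≤ n := mul_le_of_le_one_right n.cast_nonneg l3
      linarith
    set q : ℝ := Real.exp (b * Real.log 2 * n) with hq
    have hq1 : 1 ≤ q := Real.one_le_exp (by positivity)
    have l5 : (n : ℝ) ≤ q / (b * Real.log 2) := by
      rw [le_div_iff₀ (by positivity)]
      have := Real.add_one_le_exp (b * Real.log 2 * n)
      linarith
    have l6 : Ξ₁ ω + 1 + 4 * n ≤ (Ξ₁ ω + 1 + 4 / (b * Real.log 2)) * q := by
      have := hΞ₁0 ω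
      have e : (Ξ₁ ω + 1 + 4 / (b * Real.log 2)) * q =
        (Ξ₁ ω + 1) * q + 4 * (q / (b * Real.log 2)) := by ring
      rw [e]
      nlinarith
    have hqr : q * (1 / 2 ^ n) = (((2 : ℝ) ^ (-a)) ^ n) ^ 2 := by
      have e1 : (1 / 2 ^ n : ℝ) = Real.exp (-(Real.log 2 * n)) := by
        rw [Real.exp_neg, mul_comm, Real.exp_nat_mul, Real.exp_log two_pos, one_div]
      rw [e1, hq, ← Real.exp_add, Real.rpow_def_of_pos two_pos, ← Real.exp_nat_mul,
        ← Real.exp_nat_mul, hb]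
      congr 1
      push_cast
      ring
    refine abs_le_of_sq_le_sq ?_ (by positivity)
    calc _ ≤ _ := g
      _ ≤ (Ξ₁ ω + 1 + 4 / (b * Real.log 2)) * q * (4 * (1 / 2 ^ n)) := by
          gcongr
          exact l4.trans l6
      _ = A ω * (q * (1 / 2 ^ n)) := by simp only [hA]; ring
      _ ≤ A ω ^ 2 * (q * (1 / 2 ^ n)) := by
          gcongr
          exact le_self_pow₀ (hA1 ω) two_ne_zero
      _ = _ := by rw [hqr]; ring)
  refine ⟨fun s t hs ht => (hh s t hs ht).trans (by gcongr; exact le_max_left _ _), ?_⟩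
  intro h N hN
  refine le_trans ?_ (le_max_right _ _)
  exact sum_sq_pathIncrement_le ha (by positivity) (hΞ₂0 ω) hh (fun k j => h2 (k, j)) h N hN

/-! ### Pathwise preservation of quadratic invariants -/

/-- The Lipschitz hypothesis concerns the Itô drift, but the method uses `f`. The correction `½ g'
g` grows linearly because the Lipschitz constant of `g` bounds its derivative. -/
theorem exists_linear_growth {d : ℕ} {f g : EuclideanSpace ℝ (Fin d) → EuclideanSpace ℝ (Fin d)}
    {L : ℝ} (hLip : ∀ x y, ‖itoDrift f g y - itoDrift f g x‖ + ‖g y - g x‖ ≤ L * ‖y - x‖) :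
    ∃ (L' : ℝ≥0) (K : ℝ), LipschitzWith L' g ∧ 0 ≤ K ∧ (∀ y, ‖f y‖ ≤ K * (1 + ‖y‖)) ∧
      ∀ y, ‖g y‖ ≤ K * (1 + ‖y‖) := by
  set L' : ℝ≥0 := ‖L‖₊ with hL'
  have hLL : L ≤ L' := by rw [hL', coe_nnnorm]; exact le_abs_self L
  have hle : ∀ x y, ‖itoDrift f g y - itoDrift f g x‖ + ‖g y - g x‖ ≤ L' * ‖y - x‖ := fun x y =>
    (hLip x y).trans (by gcongr)
  have hg : LipschitzWith L' g := LipschitzWith.of_dist_le_mul fun x y => by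
    have := hle y x
    rw [dist_eq_norm, dist_eq_norm]
    linarith [norm_nonneg (itoDrift f g x - itoDrift f g y)]
  have grow : ∀ {F : EuclideanSpace ℝ (Fin d) → EuclideanSpace ℝ (Fin d)},
      (∀ y, ‖F y - F 0‖ ≤ L' * ‖y‖) → ∀ y, ‖F y‖ ≤ ‖F 0‖ + L' * ‖y‖ := by
    intro F hF y
    have : ‖F y‖ ≤ ‖F 0‖ + ‖F y - F 0‖ := by simpa using norm_add_le (F 0) (F y - F 0)
    linarith [hF y]
  have hi := grow (F := itoDrift f g) fun y => by
    have := hle 0 y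
    rw [sub_zero] at this
    linarith [norm_nonneg (g y - g 0)]
  have hg' := grow (F := g) fun y => by
    have := hle 0 y
    rw [sub_zero] at this
    linarith [norm_nonneg (itoDrift f g y - itoDrift f g 0)]
  set c := ‖itoDrift f g 0‖ with hc
  set e := ‖g 0‖ with he
  have hc0 : 0 ≤ c := norm_nonneg _
  have he0 : 0 ≤ e := norm_nonneg _
  have hL0 : (0 : ℝ) ≤ L' := L'.coe_nonneg
  refine ⟨L', (c + L') + (1 + L') * (e + L'), hg, by positivity, fun y => ?_, fun y => ?_⟩
  · have h1 : f y = itoDrift f g y - (1 / 2 : ℝ) • fderiv ℝ g y (g y) := by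
      simp [itoDrift]
    have h2 : ‖fderiv ℝ g y (g y)‖ ≤ L' * ‖g y‖ :=
      (ContinuousLinearMap.le_opNorm _ _).trans
        (by gcongr; exact norm_fderiv_le_of_lipschitz ℝ hg)
    have h3 : ‖f y‖ ≤ ‖itoDrift f g y‖ + ‖fderiv ℝ g y (g y)‖ := by
      conv_lhs => rw [h1]
      refine (norm_sub_le _ _).trans ?_
      rw [norm_smul]
      norm_num
      linarith [norm_nonneg (fderiv ℝ g y (g y))]
    have h4 : ‖itoDrift f g y‖ ≤ (c + L') * (1 + ‖y‖) := by nlinarith [hi y, norm_nonneg y]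
    have h5 : ‖g y‖ ≤ (e + L') * (1 + ‖y‖) := by nlinarith [hg' y, norm_nonneg y]
    have h6 : L' * ‖g y‖ ≤ L' * ((e + L') * (1 + ‖y‖)) := by gcongr
    have h7 : 0 ≤ (e + L') * (1 + ‖y‖) := by positivity
    linarith
  · have h5 : ‖g y‖ ≤ (e + L') * (1 + ‖y‖) := by nlinarith [hg' y, norm_nonneg y]
    have h6 : 0 ≤ (c + L') * (1 + ‖y‖) := by positivity
    have h7 : 0 ≤ L' * ((e + L') * (1 + ‖y‖)) := by positivity
    linarith

theorem IsRegularPath.abs_pathIncrement_le {a R : ℝ} {w : ℝ≥0 → ℝ} (hw : IsRegularPath a R w)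
    {h : ℝ≥0} {N n : ℕ} (hN : (N : ℝ) * h ≤ 1) (hn : n < N) :
    |pathIncrement w h n| ≤ R * (h : ℝ) ^ a := by
  have hn' : (n : ℝ) + 1 ≤ N := by exact_mod_cast hn
  have h1 : ((n : ℝ) + 1) * h ≤ 1 := (mul_le_mul_of_nonneg_right hn' h.coe_nonneg).trans hN
  have h2 : (n : ℝ) * h ≤ 1 := by linarith [h.coe_nonneg]
  have := hw.holder ((n + 1) * h) (n * h) (by exact_mod_cast h1) (by exact_mod_cast h2)
  push_cast at this
  rw [show ((n : ℝ) + 1) * h - n * h = h by ring, abs_of_nonneg h.coe_nonneg] at this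
  exact this

namespace SRKMethod

/-- This is the deterministic core: `K` and `ρ` depend on the path and the initial value only
through the common bound `R`. -/
theorem exists_pathwise_bound {d : ℕ}
    {f g : EuclideanSpace ℝ (Fin d) → EuclideanSpace ℝ (Fin d)}
    (hf : ContDiff ℝ (⊤ : ℕ∞) f) (hg : ContDiff ℝ (⊤ : ℕ∞) g) {L : ℝ}
    (hLip : ∀ x y, ‖itoDrift f g y - itoDrift f g x‖ + ‖g y - g x‖ ≤ L * ‖y - x‖)
    {C : Matrix (Fin d) (Fin d) ℝ} (hC : C.IsSymm) (hinv : IsSDEInvariant f g (quadForm C))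
    {s : ℕ} (M : SRKMethod s) {p : ℕ}
    (h0 : ∀ ι ι' : ColouredTree, ι.rootColour = 0 → ι'.rootColour = 0 →
      ι.weight + ι'.weight < p → M.Φ ι ⬝ᵥ M.M0 *ᵥ M.Φ ι' = 0)
    (hstar : ∀ ι ι' : ColouredTree, ι.rootColour = 0 → ι'.rootColour = 1 →
      ι.weight + ι'.weight < p → M.Φ ι ⬝ᵥ M.Mstar *ᵥ M.Φ ι' = 0)
    (h1 : ∀ ι ι' : ColouredTree, ι.rootColour = 1 → ι'.rootColour = 1 →
      ι.weight + ι'.weight < p → M.Φ ι ⬝ᵥ M.M1 *ᵥ M.Φ ι' = 0)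
    {a : ℝ} (ha : 0 < a) (ha' : a ≤ 1 / 2) {R : ℝ} (hR : 1 ≤ R) :
    ∃ K ρ : ℝ, 0 ≤ K ∧ 0 < ρ ∧ ρ ≤ 1 ∧ (M.IsExplicit → ρ = 1) ∧
      ∀ (w : ℝ≥0 → ℝ) (h : ℝ≥0) (N : ℕ) (Y : ℕ → Fin s → EuclideanSpace ℝ (Fin d))
        (y : ℕ → EuclideanSpace ℝ (Fin d)), IsRegularPath a R w → 0 < h → (h : ℝ) ≤ ρ →
        (N : ℝ) * h ≤ 1 → M.IsNumericalSolution f g h (pathIncrement w h) N Y y → ‖y 0‖ ≤ R →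
          |quadForm C (y N) - quadForm C (y 0)| ≤ K * (h : ℝ) ^ (a * p - 1) := by
  classical
  have hR0 : 0 ≤ R := by linarith
  obtain ⟨L', K, hL', hK, hfK, hgK⟩ := exists_linear_growth hLip
  obtain ⟨φ, hφ⟩ := exists_isGlobalFlow hg hL'
  obtain ⟨K₁, η, hK₁, hη, hstage⟩ := M.exists_stage_bound hK hfK hgK (H := 1 + R) (by linarith)
  obtain ⟨K₂, hK₂, hstep⟩ := M.exists_step_bound hK hfK hL' (H := 1 + R) (by linarith) hK₁
  obtain ⟨R', hR'0, hbound⟩ := hφ.exists_bound hL' hK hgK (∑ i, M.β i) hK₂ hR0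
  set R'' := R' + K₁ * (1 + R) * (1 + R') with hR''
  have hpos : 0 ≤ K₁ * (1 + R) * (1 + R') := by positivity
  obtain ⟨K₃, hK₃, hlocal⟩ := M.exists_local_error_bound hf hg hC hinv h0 hstar h1 R'' R
  -- The second value of `ρ` is equivalent to `(1 + R) * h ^ a ≤ η`, the smallness needed for
  -- implicit stages.
  refine ⟨K₃ * R ^ p, if M.IsExplicit then 1 else min 1 ((η / (1 + R)) ^ (1 / a)), by positivity,
    ?_, ?_, fun h => if_pos h, ?_⟩
  · split_ifs <;> positivity
  · split_ifs
    · exact le_rfl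
    · exact min_le_left _ _
  intro w h N Y y hw hh hhρ hN hsol hy0
  have hh0 : (0 : ℝ) < h := hh
  have hh1 : (h : ℝ) ≤ 1 := hhρ.trans (by
    split_ifs
    · exact le_rfl
    · exact min_le_left _ _)
  have hha : (h : ℝ) ≤ (h : ℝ) ^ a := by
    simpa using Real.rpow_le_rpow_of_exponent_ge hh0 hh1 (by linarith : a ≤ 1)
  have hha1 : (h : ℝ) ^ a ≤ 1 := Real.rpow_le_one hh0.le hh1 ha.le
  have hha0 : 0 ≤ (h : ℝ) ^ a := by positivity
  have hor : M.IsExplicit ∨ (1 + R) * (h : ℝ) ^ a ≤ η := by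
    by_cases hexp : M.IsExplicit
    · exact Or.inl hexp
    · refine Or.inr ?_
      rw [if_neg hexp] at hhρ
      have h2 := Real.rpow_le_rpow hh0.le (hhρ.trans (min_le_right _ _)) ha.le
      rw [← Real.rpow_mul (by positivity), one_div_mul_cancel ha.ne', Real.rpow_one,
        le_div_iff₀ (by linarith)] at h2
      linarith
  have hinc : ∀ n < N, |pathIncrement w h n| ≤ R * (h : ℝ) ^ a := fun n hn =>
    hw.abs_pathIncrement_le hN hn
  have hsum : ∀ n < N, (h : ℝ) + |pathIncrement w h n| ≤ (1 + R) * (h : ℝ) ^ a := fun n hn => by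
    linarith [hinc n hn]
  have hH : ∀ n < N, (h : ℝ) + |pathIncrement w h n| ≤ 1 + R := fun n hn =>
    (hsum n hn).trans (mul_le_of_le_one_right (by linarith) hha1)
  have hYy : ∀ n < N, ∀ i, ‖Y n i - y n‖ ≤ K₁ * (h + |pathIncrement w h n|) * (1 + ‖y n‖) :=
    fun n hn => hstage h (pathIncrement w h n) (y n) (Y n) hh0.le (hH n hn)
      (hor.imp_right fun h2 => (hsum n hn).trans h2) (hsol.stage n hn)
  set S : ℕ → ℝ := fun n => w (n * h) - w 0 with hS
  have hSinc : ∀ n, S (n + 1) - S n = pathIncrement w h n := fun n => by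
    simp only [hS, pathIncrement]
    push_cast
    ring
  have hyb := hbound h N y S hh0.le hN hy0 (by simp [hS]) (fun n hn => by
      have hn' : (n : ℝ) ≤ N := by exact_mod_cast hn
      have h2 : (n : ℝ) * h ≤ 1 := (mul_le_mul_of_nonneg_right hn' hh0.le).trans hN
      refine (hw.holder (n * h) 0 (by exact_mod_cast h2) zero_le_one).trans
        (mul_le_of_le_one_right hR0 (Real.rpow_le_one (abs_nonneg _) ?_ ha.le))
      push_cast
      rw [sub_zero, abs_of_nonneg (by positivity)]
      exact h2)
    (by simpa only [hSinc] using hw.sum_sq_le h N hN)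
    (fun n hn => by
      rw [hSinc, hsol.step n hn]
      exact hstep h (pathIncrement w h n) (y n) (Y n) hh0.le (hH n hn) (hYy n hn))
  have hloc : ∀ n < N, |quadForm C (y (n + 1)) - quadForm C (y n)| ≤
      K₃ * (R * (h : ℝ) ^ a) ^ p := by
    intro n hn
    -- The scale is `θ = R * h ^ a`; `h ≤ θ ^ 2` holds because `2 * a ≤ 1`, `h ≤ 1` and `R ≥ 1`.
    refine hlocal h (pathIncrement w h n) (R * (h : ℝ) ^ a) (y n) (y (n + 1)) (Y n) (by positivity)
      (mul_le_of_le_one_right hR0 hha1) ?_ (hinc n hn) ((hyb n hn.le).trans (by linarith)) ?_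
      (hsol.stage n hn) (hsol.step n hn)
    · rw [abs_of_pos hh0, mul_pow]
      have h2 : (h : ℝ) ≤ ((h : ℝ) ^ a) ^ 2 := by
        rw [← Real.rpow_natCast, ← Real.rpow_mul hh0.le]
        simpa using Real.rpow_le_rpow_of_exponent_ge hh0 hh1
          (by push_cast; linarith : a * ((2 : ℕ) : ℝ) ≤ 1)
      exact h2.trans (le_mul_of_one_le_left (by positivity) (one_le_pow₀ hR))
    · intro i
      refine (hYy n hn i).trans (le_trans ?_ (by linarith : K₁ * (1 + R) * (1 + R') ≤ R''))
      have := hyb n hn.le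
      have := hH n hn
      gcongr
  have htel : |quadForm C (y N) - quadForm C (y 0)| ≤ N * (K₃ * (R * (h : ℝ) ^ a) ^ p) := by
    rw [← Finset.sum_range_sub (fun n => quadForm C (y n)) N]
    refine (Finset.abs_sum_le_sum_abs _ _).trans ?_
    refine (Finset.sum_le_card_nsmul _ _ _ fun n hn => hloc n (Finset.mem_range.1 hn)).trans ?_
    simp
  refine htel.trans ?_
  have hN' : (N : ℝ) ≤ (h : ℝ)⁻¹ := by rw [← one_div, le_div_iff₀ hh0]; exact hN
  calc (N : ℝ) * (K₃ * (R * (h : ℝ) ^ a) ^ p) ≤ (h : ℝ)⁻¹ * (K₃ * (R * (h : ℝ) ^ a) ^ p) := by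
        gcongr
    _ = K₃ * R ^ p * (((h : ℝ) ^ a) ^ p * (h : ℝ)⁻¹) := by rw [mul_pow]; ring
    _ = _ := by
        rw [← Real.rpow_mul_natCast hh0.le, ← Real.rpow_neg_one, ← Real.rpow_add hh0,
          ← sub_eq_add_neg]

end SRKMethod

/-! ### From half-integer orders to integer weights, and the final assembly -/

theorem ColouredTree.ord_add_ord_le_iff (ι ι' : ColouredTree) (m : ℕ) :
    ι.ord + ι'.ord ≤ (m / 2 : ℝ) + 1 / 2 ↔ ι.weight + ι'.weight < m + 2 := by
  have h1 := ι.two_mul_ord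
  have h2 := ι'.two_mul_ord
  rw [show m + 2 = (m + 1) + 1 from rfl, Nat.lt_succ_iff, ← Nat.cast_le (α := ℝ)]
  push_cast
  constructor <;> intro h <;> linarith

theorem mainTheorem2 {Ω : Type*} [MeasurableSpace Ω] (P : Measure Ω) [IsProbabilityMeasure P]
    (W : ℝ≥0 → Ω → ℝ) (hW : IsBrownianReal W P)
    {d : ℕ} (f g : EuclideanSpace ℝ (Fin d) → EuclideanSpace ℝ (Fin d))
    (hf : ContDiff ℝ (⊤ : ℕ∞) f) (hg : ContDiff ℝ (⊤ : ℕ∞) g)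
    (L₁ L₂ : ℝ)
    (hLip : ∀ x y, ‖itoDrift f g y - itoDrift f g x‖ + ‖g y - g x‖ ≤ L₁ * ‖y - x‖)
    (hGrowth : ∀ y, ‖itoDrift f g y‖ ^ 2 + ‖g y‖ ^ 2 ≤ L₂ * (1 + ‖y‖ ^ 2))
    (y₀ : Ω → EuclideanSpace ℝ (Fin d)) (hy₀ : MemLp y₀ 2 P)
    (hindep : IndepFun y₀ (fun ω t => W t ω) P)
    (C : Matrix (Fin d) (Fin d) ℝ) (hC : C.IsSymm) (hinv : IsSDEInvariant f g (quadForm C))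
    {s : ℕ} (M : SRKMethod s)
    (γ : ℝ) (hγ : ∃ m : ℕ, γ = m / 2)
    (h0 : ∀ ι ι' : ColouredTree, ι.rootColour = 0 → ι'.rootColour = 0 →
      ι.ord + ι'.ord ≤ γ + 1 / 2 → M.Φ ι ⬝ᵥ M.M0 *ᵥ M.Φ ι' = 0)
    (hstar : ∀ ι ι' : ColouredTree, ι.rootColour = 0 → ι'.rootColour = 1 →
      ι.ord + ι'.ord ≤ γ + 1 / 2 → M.Φ ι ⬝ᵥ M.Mstar *ᵥ M.Φ ι' = 0)
    (h1 : ∀ ι ι' : ColouredTree, ι.rootColour = 1 → ι'.rootColour = 1 →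
      ι.ord + ι'.ord ≤ γ + 1 / 2 → M.Φ ι ⬝ᵥ M.M1 *ᵥ M.Φ ι' = 0)
    (ε : ℝ) (hε : 0 < ε) :
    ∃ K ρ : Ω → ℝ, Measurable K ∧ Measurable ρ ∧ (∀ ω, 0 ≤ K ω) ∧
      (∀ ω, 0 < ρ ω ∧ ρ ω ≤ 1) ∧ (M.IsExplicit → ∀ ω, ρ ω = 1) ∧
      ∀ᵐ ω ∂P, ∀ (h : ℝ≥0) (N : ℕ), 0 < h → (h : ℝ) ≤ ρ ω → (N : ℝ) * h ≤ 1 →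
        ∀ (Y : ℕ → Fin s → EuclideanSpace ℝ (Fin d)) (y : ℕ → EuclideanSpace ℝ (Fin d)),
          M.IsNumericalSolution f g h (pathIncrement (fun t => W t ω) h) N Y y →
          y 0 = y₀ ω →
          |quadForm C (y N) - quadForm C (y₀ ω)| ≤ K ω * (h : ℝ) ^ (γ - ε) := by
  obtain ⟨m, rfl⟩ := hγ
  -- With `p = m + 2`, the exponent `a * p - 1` falls short of `γ = m / 2` by `min (1/4) (ε / (m +
  -- 2)) * (m + 2) ≤ ε`. The cap `1/4` keeps `a ≥ 1/4`.
  set a : ℝ := 1 / 2 - min (1 / 4) (ε / (m + 2)) with ha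
  have hδ : 0 < min (1 / 4) (ε / ((m : ℝ) + 2)) := by positivity
  have ha1 : 1 / 4 ≤ a := by linarith [min_le_left (1 / 4) (ε / ((m : ℝ) + 2))]
  have ha2 : a < 1 / 2 := by linarith
  have hexpo : (m / 2 : ℝ) - ε ≤ a * ((m + 2 : ℕ) : ℝ) - 1 := by
    have h2 := mul_le_mul_of_nonneg_right (min_le_right (1 / 4) (ε / ((m : ℝ) + 2)))
      (by positivity : (0 : ℝ) ≤ (m : ℝ) + 2)
    rw [div_mul_cancel₀ _ (by positivity)] at h2
    push_cast
    rw [ha, sub_mul]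
    linarith
  have hdet := fun R : ℕ => M.exists_pathwise_bound hf hg hLip hC hinv (p := m + 2)
    (fun ι ι' h h' hlt => h0 ι ι' h h' ((ι.ord_add_ord_le_iff ι' m).2 hlt))
    (fun ι ι' h h' hlt => hstar ι ι' h h' ((ι.ord_add_ord_le_iff ι' m).2 hlt))
    (fun ι ι' h h' hlt => h1 ι ι' h h' ((ι.ord_add_ord_le_iff ι' m).2 hlt))
    (by linarith : 0 < a) ha2.le (R := (R : ℝ) + 1) (by linarith [R.cast_nonneg (α := ℝ)])
  choose K ρ hK hρ hρ1 hexp hmain using hdet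
  obtain ⟨R, hRm, hR⟩ := hW.exists_isRegularPath ha1 ha2
  have hym := hy₀.aestronglyMeasurable.aemeasurable
  -- Rounding the random bound up to a natural number makes `K (Q ω)` and `ρ (Q ω)` measurable,
  -- although `K` and `ρ` were merely chosen. The shift to `Q + 1` ensures that the bound is at
  -- least `1`.
  let Q : Ω → ℕ := fun ω => ⌈max (R ω) ‖hym.mk y₀ ω‖⌉₊
  have hQ : Measurable Q := (hRm.max hym.measurable_mk.norm).nat_ceil
  refine ⟨fun ω => K (Q ω), fun ω => ρ (Q ω), measurable_from_nat.comp hQ,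
    measurable_from_nat.comp hQ, fun ω => hK _, fun ω => ⟨hρ _, hρ1 _⟩,
    fun h ω => hexp _ h, ?_⟩
  filter_upwards [hR, hym.ae_eq_mk] with ω hω hyω h N hh hhρ hN Y y hsol hy0
  have hQω : max (R ω) ‖hym.mk y₀ ω‖ ≤ (Q ω : ℝ) + 1 :=
    (Nat.le_ceil _).trans (by simp [Q])
  have key := hmain (Q ω) (fun t => W t ω) h N Y y
    (hω.mono ((le_max_left _ _).trans hQω)) hh hhρ hN hsol
    (by rw [hy0, hyω]; exact (le_max_right _ _).trans hQω)
  rw [hy0] at key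
  refine key.trans (mul_le_mul_of_nonneg_left ?_ (hK _))
  exact Real.rpow_le_rpow_of_exponent_ge hh (hhρ.trans (hρ1 _)) hexpo
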